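/- **Conventions.** Let $\Gamma$ be a countable (discrete) group. A *Lebesgue $\Gamma$-space* is a standard Borel space $\Omega$ with a probability measure $\mu$ and a measurable action of $\Gamma$ preserving the class of $\mu$. For a Borel $\Gamma$-space $V$, $\operatorname{Map}_\Gamma(\Omega,V)$ is the set of measurable maps $f:\Omega\to V$ such that for every $g\in\Gamma$, $f(g\omega)=g f(\omega)$ for a.e. $\omega$, where maps that agree a.e. are identified. The action on $\Omega$ is *amenable* if (Zimmer) for every separable Banach space $E$, every measurable cocycle $\alpha:\Gamma\times\Omega\to\operatorname{Isom}(E)$ into the linear isometries, and every $\alpha$-invariant measurable field $(A_\omega)$ of non-empty weak-* compact convex subsets of the unit ball of $E^*$, there is a measurable $s:\Omega\to E^*$ with $s(\omega)\in A_\omega$ a.e. which is $\alpha$-invariant, i.e. for every $g$, $s(g\omega)=s(\omega)\circ\alpha(g,\omega)^{-1}$ for a.e. $\omega$. An equivariant map $p:\Omega\to Y$ of Lebesgue $\Gamma$-spaces is *relatively metrically ergodic* if for every measurable family $(S_y,d_y)_{y\in Y}$ of separable metric spaces (the fibers of a Borel map $q:M\to Y$ from a standard Borel space, with a Borel function $d$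 on $M\times_Y M$ that is a separable metric on each fiber) with a Borel $q$-equivariant action of $\Gamma$ on $M$ by isometries $S_y\to S_{gy}$, every $\Gamma$-map $F:\Omega\to M$ with $F(\omega)\in S_{p(\omega)}$ a.e. agrees a.e. with $f\circ p$ for some $\Gamma$-map $f:Y\to M$ with $f(y)\in S_y$ a.e. A pair $(B_-,B_+)$ of Lebesgue $\Gamma$-spaces is a *boundary pair* if both actions are amenable and both projections $\operatorname{pr}_\pm:B_-\times B_+\to B_\pm$ (product measure, diagonal action) are relatively metrically ergodic. The Gromov product is $(x,y)_o=\frac12(d(o,x)+d(o,y)-d(x,y))$, and $X$ is *Gromov hyperbolic* if for some $\delta$ one has $(x,z)_o\ge\min\{(x,y)_o,(y,z)_o\}-\delta$ for all $o,x,y,z\in X$. The *Gromov boundary* $\partial X$ is the set of sequences in $X$ with $(x_n,x_m)_o\to\infty$ as $n,m\to\infty$, modulo $(x_n)\sim(y_n)$ iff $(x_n,y_n)_o\to\infty$. It has the topology in which the sets $U(\xi,r)=\{\eta:\sup\{\liminf_n (x_n,y_n)_o : (x_n)\in\xi,(y_n)\in\eta\}\ge r\}$, $r>0$, form a neighbourhood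 basis at $\xi$, and the corresponding Borel structure. $\operatorname{Prob}(\partial X)$ is the space of Borel probability measures on $\partial X$, with the $\sigma$-algebra generated by evaluations on Borel sets and the push-forward action, and $\partial X^{(2)}=\{(\xi,\eta)\in\partial X^2:\xi\ne\eta\}$. **Theorem.** Let $(B_-,B_+)$ be a boundary pair for the countable group $\Gamma$. Let $(X,d)$ be a non-empty separable, geodesic, Gromov hyperbolic (possibly non-proper) metric space on which $\Gamma$ acts by isometries. Assume that no non-empty bounded subset of $X$ is $\Gamma$-invariant, that $\Gamma$ fixes no point of $\partial X$, and that no subset $\{\xi,\eta\}\subset\partial X$ with $\xi\neq\eta$ is $\Gamma$-invariant. Then there are $\phi_-\in\operatorname{Map}_\Gamma(B_-,\partial X)$ and $\phi_+\in\operatorname{Map}_\Gamma(B_+,\partial X)$, each the only element of its $\operatorname{Map}_\Gamma$, such that $\phi_{\bowtie}\in\operatorname{Map}_\Gamma(B_-\times B_+,\partial X^2)$, $\phi_{\bowtie}(x,y)=(\phi_-(x),\phi_+(y))$, takes a.e. values in $\partial X^{(2)}$. Moreover: 1. $\operatorname{Map}_\Gamma(B_-,\operatorname{Prob}(\partial X))=\{\delta\circ\phi_-\}$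 and $\operatorname{Map}_\Gamma(B_+,\operatorname{Prob}(\partial X))=\{\delta\circ\phi_+\}$, where $\delta(\xi)$ is the Dirac measure at $\xi$; 2. $\operatorname{Map}_\Gamma(B_-\times B_+,\partial X)=\{\phi_-\circ\operatorname{pr}_-,\ \phi_+\circ\operatorname{pr}_+\}$; 3. $\operatorname{Map}_\Gamma(B_-\times B_+,\partial X^{(2)})=\{\phi_{\bowtie},\ \tau\circ\phi_{\bowtie}\}$, where $\tau(\xi,\xi')=(\xi',\xi)$. -/

import Mathlib

open MeasureTheory Filter Topology Set

namespace BoundaryMaps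

noncomputable section

/-! ## Gromov hyperbolic spaces and their boundary -/

section Hyperbolic

variable {X : Type*} [MetricSpace X]

/-- The Gromov product `(x, y)` based at `o`. -/
def gromovProduct (o x y : X) : ℝ := (dist o x + dist o y - dist x y) / 2

theorem gromovProduct_smul {Γ : Type*} [Group Γ] [MulAction Γ X] [IsIsometricSMul Γ X]
    (g : Γ) (o x y : X) :
    gromovProduct o (g • x) (g • y) = gromovProduct (g⁻¹ • o) x y := by
  have h : ∀ z : X, dist o (g • z) = dist (g⁻¹ • o) z := fun z => by
    rw [← dist_smul g (g⁻¹ • o) z, smul_inv_smul]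
  simp only [gromovProduct, h, dist_smul]

/-- Gromov's four-point condition. -/
class IsGromovHyperbolic (X : Type*) [MetricSpace X] : Prop where
  exists_delta : ∃ δ : ℝ, ∀ o x y z : X,
    min (gromovProduct o x y) (gromovProduct o y z) - δ ≤ gromovProduct o x z

/-- Any two points are joined by a geodesic segment. -/
def IsGeodesicSpace (X : Type*) [MetricSpace X] : Prop :=
  ∀ x y : X, ∃ c : ℝ → X, c 0 = x ∧ c (dist x y) = y ∧
    ∀ s ∈ Icc 0 (dist x y), ∀ t ∈ Icc 0 (dist x y), dist (c s) (c t) = |s - t|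

/-- The sequence `u` converges to infinity: `(u m, u n) → ∞` as both `m` and `n` tend to infinity
(for one base point, equivalently for all of them). -/
def ConvergesToInfinity (u : ℕ → X) : Prop :=
  ∀ o : X, Tendsto (fun p : ℕ × ℕ => gromovProduct o (u p.1) (u p.2)) atTop atTop

variable (X) in
/-- Sequences in `X` which converge to infinity. -/
def SeqToInfinity : Type _ := {u : ℕ → X // ConvergesToInfinity u}

variable {Γ : Type*} [Group Γ] [MulAction Γ X] [IsIsometricSMul Γ X]

instance : MulAction Γ (SeqToInfinity X) where
  smul g u := ⟨fun n => g • u.1 n, fun o => by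
    simpa only [gromovProduct_smul] using u.2 (g⁻¹ • o)⟩
  one_smul u := Subtype.ext (funext fun n => one_smul Γ (u.1 n))
  mul_smul g h u := Subtype.ext (funext fun n => mul_smul g h (u.1 n))

theorem smul_seq_apply (g : Γ) (u : SeqToInfinity X) (n : ℕ) : (g • u).1 n = g • u.1 n := rfl

variable (X) in
/-- Two sequences converging to infinity are equivalent if `(u n, v n) → ∞`. -/
instance seqSetoid [IsGromovHyperbolic X] : Setoid (SeqToInfinity X) where
  r u v := ∀ o : X, Tendsto (fun n => gromovProduct o (u.1 n) (v.1 n)) atTop atTop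
  iseqv :=
    { refl := fun u o => (u.2 o).comp (tendsto_atTop_diagonal)
      symm := fun {u v} h o => by
        have := h o
        refine this.congr fun n => ?_
        simp only [gromovProduct, dist_comm (u.1 n) (v.1 n)]
        ring
      trans := fun {u v w} h k o => by
        obtain ⟨δ, hδ⟩ := IsGromovHyperbolic.exists_delta (X := X)
        rw [tendsto_atTop]
        intro b
        filter_upwards [(tendsto_atTop.1 (h o)) (b + δ), (tendsto_atTop.1 (k o)) (b + δ)]
          with n h1 h2
        have h3 := hδ o (u.1 n) (v.1 n) (w.1 n)
        have h4 := le_min h1 h2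
        linarith }

variable (X) in
/-- The Gromov boundary `∂X`. -/
def GromovBoundary [IsGromovHyperbolic X] : Type _ := Quotient (seqSetoid X)

variable [IsGromovHyperbolic X]

/-- The extended Gromov product of boundary points:
`sup {liminf (u n, v n) : u ∈ ξ, v ∈ η}`, with values in `[-∞, ∞]`. -/
def boundaryProduct (o : X) (ξ η : GromovBoundary X) : EReal :=
  ⨆ (u : SeqToInfinity X) (v : SeqToInfinity X)
    (_ : (Quotient.mk _ u : GromovBoundary X) = ξ) (_ : (Quotient.mk _ v : GromovBoundary X) = η),
    liminf (fun n => ((gromovProduct o (u.1 n) (v.1 n) : ℝ) : EReal)) atTop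

/-- The basic neighbourhood `U(ξ, r)` of a boundary point. -/
def boundaryNhd (o : X) (ξ : GromovBoundary X) (r : ℝ) : Set (GromovBoundary X) :=
  {η | (r : EReal) ≤ boundaryProduct o ξ η}

/-- The usual topology on `∂X`, in which the sets `U(ξ, r)` are the basic neighbourhoods of `ξ`. -/
instance : TopologicalSpace (GromovBoundary X) where
  IsOpen V := ∀ o : X, ∀ ξ ∈ V, ∃ r : ℝ, boundaryNhd o ξ r ⊆ V
  isOpen_univ := fun _ _ _ => ⟨0, subset_univ _⟩
  isOpen_inter := fun V W hV hW o ξ hξ => by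
    obtain ⟨r, hr⟩ := hV o ξ hξ.1
    obtain ⟨s, hs⟩ := hW o ξ hξ.2
    refine ⟨max r s, fun η hη => ⟨hr ?_, hs ?_⟩⟩
    · exact le_trans (EReal.coe_le_coe_iff.2 (le_max_left r s)) hη
    · exact le_trans (EReal.coe_le_coe_iff.2 (le_max_right r s)) hη
  isOpen_sUnion := fun S hS o ξ ⟨V, hV, hξ⟩ => by
    obtain ⟨r, hr⟩ := hS V hV o ξ hξ
    exact ⟨r, hr.trans (subset_sUnion_of_mem hV)⟩

/-- The Borel structure of `∂X`. -/
instance : MeasurableSpace (GromovBoundary X) := borel _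

instance : BorelSpace (GromovBoundary X) := ⟨rfl⟩

/-- The action on the boundary induced by an isometric action on `X`: `g • [u n] = [g • u n]`. -/
instance : MulAction Γ (GromovBoundary X) where
  smul g := Quotient.map (fun u => g • u) fun u v h o => by
    simpa only [smul_seq_apply, gromovProduct_smul] using h (g⁻¹ • o)
  one_smul ξ := by
    induction ξ using Quotient.inductionOn with
    | h u => exact congrArg (Quotient.mk _) (one_smul Γ u)
  mul_smul g h ξ := by
    induction ξ using Quotient.inductionOn with
    | h u => exact congrArg (Quotient.mk _) (mul_smul g h u)

theorem smul_mk (g : Γ) (u : SeqToInfinity X) :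
    g • (show GromovBoundary X from Quotient.mk _ u) = Quotient.mk _ (g • u) := rfl

theorem boundaryProduct_le_smul (g : Γ) (o : X) (ξ η : GromovBoundary X) :
    boundaryProduct o ξ η ≤ boundaryProduct (g • o) (g • ξ) (g • η) := by
  refine iSup_le fun u => iSup_le fun v => iSup_le fun hu => iSup_le fun hv => ?_
  refine le_trans (le_of_eq ?_) (le_iSup_of_le (g • u) (le_iSup_of_le (g • v)
    (le_iSup_of_le (by rw [← hu, smul_mk]) (le_iSup_of_le (by rw [← hv, smul_mk]) le_rfl))))
  simp only [smul_seq_apply, gromovProduct_smul, inv_smul_smul]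

instance : ContinuousConstSMul Γ (GromovBoundary X) where
  continuous_const_smul g := ⟨fun V hV o ξ hξ => by
    obtain ⟨r, hr⟩ := hV (g • o) (g • ξ) hξ
    exact ⟨r, fun η hη => hr (le_trans hη (boundaryProduct_le_smul g o ξ η))⟩⟩

instance : MeasurableConstSMul Γ (GromovBoundary X) where
  measurable_const_smul g := (continuous_const_smul g).measurable

variable (X) in
/-- The set `∂X⁽²⁾` of pairs of distinct boundary points. -/
def DistinctPairs : Type _ := {p : GromovBoundary X × GromovBoundary X // p.1 ≠ p.2}

instance : MeasurableSpace (DistinctPairs X) := Subtype.instMeasurableSpace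

/-- The diagonal action on `∂X⁽²⁾`. -/
instance : MulAction Γ (DistinctPairs X) where
  smul g p := ⟨g • p.1, fun h => p.2 (MulAction.injective g h)⟩
  one_smul p := Subtype.ext (one_smul Γ p.1)
  mul_smul g h p := Subtype.ext (mul_smul g h p.1)

end Hyperbolic

/-- The action of `Γ` on `Prob(V)` by push-forward, for a Borel action of `Γ` on `V`. -/
instance probSMul {Γ V : Type*} [Group Γ] [MulAction Γ V] [MeasurableSpace V]
    [MeasurableConstSMul Γ V] : SMul Γ (ProbabilityMeasure V) where
  smul g m := m.map (f := fun v => g • v) (measurable_const_smul g).aemeasurable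

/-! ## Lebesgue `Γ`-spaces, for a countable discrete group `Γ` -/

section Ergodic

variable (Γ : Type*) [Group Γ]

/-- A measurable action of `Γ` which preserves the class of `μ`. -/
structure IsNonsingularAction {Ω : Type*} [MeasurableSpace Ω] [MulAction Γ Ω]
    (μ : Measure Ω) : Prop where
  measurable_smul : ∀ g : Γ, Measurable fun ω : Ω => g • ω
  null_smul : ∀ (g : Γ) (A : Set Ω), MeasurableSet A → (μ ((fun ω => g • ω) ⁻¹' A) = 0 ↔ μ A = 0)

/-- `f` is a `Γ`-map, i.e. it represents an element of `Map_Γ(Ω, V)`; two `Γ`-maps represent the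
same element if they agree `μ`-almost everywhere. -/
def IsGammaMap {Ω V : Type*} [MeasurableSpace Ω] [MulAction Γ Ω] [MeasurableSpace V] [SMul Γ V]
    (μ : Measure Ω) (f : Ω → V) : Prop :=
  Measurable f ∧ ∀ g : Γ, ∀ᵐ ω ∂μ, f (g • ω) = g • f ω

/-- A Borel action of `Γ` on `M`, a measurable family of separable metrics `d` on the fibers of the
equivariant Borel map `q : M → Y`, such that `Γ` acts by isometries between the fibers.
The fibers are the members of a measurable family of separable metric spaces over `Y`. -/
structure IsFiberwiseIsometric {M Y : Type*} [MeasurableSpace M] [MulAction Γ M]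
    [MeasurableSpace Y] [MulAction Γ Y] (q : M → Y) (d : M → M → ℝ) : Prop where
  measurable_proj : Measurable q
  measurable_smul : ∀ g : Γ, Measurable fun m : M => g • m
  measurable_metric : Measurable fun m : {m : M × M // q m.1 = q m.2} => d m.1.1 m.1.2
  nonneg : ∀ m m', q m = q m' → 0 ≤ d m m'
  eq_zero_iff : ∀ m m', q m = q m' → (d m m' = 0 ↔ m = m')
  symm : ∀ m m', q m = q m' → d m m' = d m' m
  triangle : ∀ m m' m'', q m = q m' → q m' = q m'' → d m m'' ≤ d m m' + d m' m''
  separable : ∀ y : Y, ∃ D : Set M, D.Countable ∧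
    ∀ m, q m = y → ∀ ε > 0, ∃ m' ∈ D, q m' = y ∧ d m m' < ε
  equivariant : ∀ (g : Γ) (m : M), q (g • m) = g • q m
  isometric : ∀ (g : Γ) (m m' : M), q m = q m' → d (g • m) (g • m') = d m m'

/-- Relative metric ergodicity of the equivariant map `p : (Ω, μ) → (Y, ν)`: every `Γ`-equivariant
measurable family `F(ω)`, with `F(ω)` in the fiber over `p(ω)`, of a measurable family of separable
metric spaces over `Y` on which `Γ` acts by isometries is the pull-back of an equivariant family
over `Y`. A standard Borel space has at most continuum many points, so it is enough to
let `M` range over `Type`. -/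
def IsRelativelyMetricallyErgodic {Ω Y : Type*} [MeasurableSpace Ω] [MulAction Γ Ω]
    [MeasurableSpace Y] [MulAction Γ Y] (μ : Measure Ω) (ν : Measure Y) (p : Ω → Y) : Prop :=
  ∀ (M : Type) [MeasurableSpace M] [StandardBorelSpace M] [MulAction Γ M]
    (q : M → Y) (d : M → M → ℝ), IsFiberwiseIsometric Γ q d →
    ∀ F : Ω → M, IsGammaMap Γ μ F → (∀ᵐ ω ∂μ, q (F ω) = p ω) →
      ∃ f : Y → M, IsGammaMap Γ ν f ∧ (∀ᵐ y ∂ν, q (f y) = y) ∧ F =ᵐ[μ] f ∘ p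

end Ergodic

section Amenable

/-- The measurable structure on the dual of `E` generated by evaluations; for separable `E` it is
the Borel structure of the weak-* topology. -/
instance weakDualMeasurableSpace (E : Type*) [NormedAddCommGroup E] [NormedSpace ℝ E] :
    MeasurableSpace (WeakDual ℝ E) :=
  MeasurableSpace.comap (fun (x : WeakDual ℝ E) (e : E) => x e) MeasurableSpace.pi

/-- The isometry `x ↦ x ∘ T⁻¹` of the dual of `E` induced by a linear isometry `T` of `E`. -/
def dualIsometry {E : Type*} [NormedAddCommGroup E] [NormedSpace ℝ E] (T : E ≃ₗᵢ[ℝ] E)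
    (x : WeakDual ℝ E) : WeakDual ℝ E :=
  StrongDual.toWeakDual
    ((WeakDual.toStrongDual x).comp (T.symm.toContinuousLinearEquiv : E →L[ℝ] E))

variable (Γ : Type*) [Group Γ]

/-- A measurable cocycle with values in the isometry group of the Banach space `E`. -/
structure IsIsometricCocycle {Ω E : Type*} [MeasurableSpace Ω] [MulAction Γ Ω]
    [NormedAddCommGroup E] [NormedSpace ℝ E] [MeasurableSpace E]
    (α : Γ → Ω → (E ≃ₗᵢ[ℝ] E)) : Prop where
  measurable : ∀ (g : Γ) (e : E), Measurable fun ω => α g ω e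
  cocycle : ∀ (g h : Γ) (ω : Ω) (e : E), α (g * h) ω e = α g (h • ω) (α h ω e)

/-- An `α`-invariant measurable field of non-empty weak-* compact convex subsets of the unit ball
of the dual of `E`. -/
structure IsInvariantConvexField {Ω E : Type*} [MeasurableSpace Ω] [MulAction Γ Ω]
    [NormedAddCommGroup E] [NormedSpace ℝ E]
    (α : Γ → Ω → (E ≃ₗᵢ[ℝ] E)) (A : Ω → Set (WeakDual ℝ E)) : Prop where
  nonempty : ∀ ω, (A ω).Nonempty
  convex : ∀ ω, Convex ℝ (A ω)
  isCompact : ∀ ω, IsCompact (A ω)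
  subset_ball : ∀ ω, ∀ x ∈ A ω, ∀ e : E, |x e| ≤ ‖e‖
  measurable : MeasurableSet {p : Ω × WeakDual ℝ E | p.2 ∈ A p.1}
  invariant : ∀ (g : Γ) (ω : Ω), A (g • ω) = dualIsometry (α g ω) '' A ω

/-- Amenability in the sense of Zimmer of the action of `Γ` on `(Ω, μ)`: every affine action over
`Ω` has an invariant section. A separable Banach space has at most continuum many points, so it is
enough to let `E` range over `Type`. -/
def IsAmenableAction {Ω : Type*} [MeasurableSpace Ω] [MulAction Γ Ω] (μ : Measure Ω) : Prop :=
  ∀ (E : Type) [NormedAddCommGroup E] [NormedSpace ℝ E] [CompleteSpace E]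
    [TopologicalSpace.SeparableSpace E] [MeasurableSpace E] [BorelSpace E]
    (α : Γ → Ω → (E ≃ₗᵢ[ℝ] E)) (A : Ω → Set (WeakDual ℝ E)),
    IsIsometricCocycle Γ α → IsInvariantConvexField Γ α A →
      ∃ s : Ω → WeakDual ℝ E, Measurable s ∧ (∀ᵐ ω ∂μ, s ω ∈ A ω) ∧
        ∀ g : Γ, ∀ᵐ ω ∂μ, s (g • ω) = dualIsometry (α g ω) (s ω)

end Amenable

/-- `(B₋, μ₋)` and `(B₊, μ₊)` form a boundary pair for the countable group `Γ`; the product carries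
the diagonal action and the product measure. -/
structure IsBoundaryPair (Γ : Type*) [Group Γ] {Bm Bp : Type*}
    [MeasurableSpace Bm] [MulAction Γ Bm] [MeasurableSpace Bp] [MulAction Γ Bp]
    (μm : Measure Bm) (μp : Measure Bp) : Prop where
  nonsingular_minus : IsNonsingularAction Γ μm
  nonsingular_plus : IsNonsingularAction Γ μp
  amenable_minus : IsAmenableAction Γ μm
  amenable_plus : IsAmenableAction Γ μp
  ergodic_minus : IsRelativelyMetricallyErgodic Γ (μm.prod μp) μm Prod.fst
  ergodic_plus : IsRelativelyMetricallyErgodic Γ (μm.prod μp) μp Prod.snd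

end

end BoundaryMaps

open BoundaryMaps

/-!
The maps to the boundary are found among the limits of averages of distance functions. A field of
averages assigns to every point `x` of one of the two spaces a function `h x` on `Γ` which is, up
to an additive constant, a limit of convex combinations of the functions `a ↦ d(k • o, a • o)`.
Applied to the closed convex hull of these functions, amenability gives such a field which is
equivariant modulo additive constants (`IsAmenableAction.exists_isDistField`).

By the four-point condition averages of distance functions are quasi-convex on the orbit of `o`
(`IsDistAverage.le_max`), and they cannot be bounded at the three ends of a long tripod
(`IsDistAverage.tripod`). The second fact replaces compactness, as `X` need not be proper: an
unbounded sequence of orbit points on which the average is bounded above subconverges to a boundary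
point, and there are at most two limit points of this kind. An average which is not bounded below
has a pole, i.e. all sequences along which it tends to `-∞` converge to the same boundary point.

There cannot be fields on both spaces which are exactly equivariant, with no additive constants
(`IsExactField.not_both`). By ergodicity almost all pairs of sublevel sets, at some fixed level,
would meet. Two sublevel sets on one side with disjoint limit sets then bound, by quasi-convexity,
almost all members of the field on the other side, first at the base point and then on the whole
orbit. This makes all boundary points of the orbit limit points of one sublevel set, so that `Γ`
has an invariant boundary point or pair, unless its orbits are bounded; both are excluded.

A field is made exactly equivariant by relative metric ergodicity of the projection to `B`, applied
to the bundle `B × ℝ`: it is enough to find a measurable function on the product which changes by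
the same constants as the field (`IsDistField.exists_isExactField_of_shift`), for instance an
infimum of values of the field over an equivariantly defined subset of `Γ`. So
* a field which is bounded below can be made exactly equivariant by subtracting its infimum. This
  cannot happen on both sides, and if it happens on one side only, it makes the other field exactly
  equivariant as well (`IsDistField.not_unbounded`). Hence both fields are unbounded below almost
  everywhere (`IsDistField.ae_not_bddBelow`), and their poles are the maps `φ₋` and `φ₊`;
* if a `Γ`-map from the product to `Prob(∂X)` charged the complement of `{φ₋ x, φ₊ y}`, both fields
  could be made exactly equivariant: the infimum of `h x a + q` is taken over the pairs `(a, q)` for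
  which at least half of this mass lies on points whose Gromov product with `φ₊ y`, seen from
  `a • o`, is at most `q` (`IsPoleField.exists_isExactField`).

Hence every `Γ`-map from the product to `Prob(∂X)` is concentrated on `{φ₋ x, φ₊ y}`
(`IsPoleField.ae_measure_awayFrom_eq_zero`). The classification follows from this by ergodicity,
since `φ₋` and `φ₊` are not constant.
-/

namespace BoundaryMaps

/-! ### Gromov products and convergence to boundary points -/

section GromovProduct

variable {X : Type*} [MetricSpace X]

theorem gromovProduct_comm (o x y : X) : gromovProduct o x y = gromovProduct o y x := by
  simp only [gromovProduct, dist_comm x y]; ring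

theorem gromovProduct_nonneg (o x y : X) : 0 ≤ gromovProduct o x y := by
  have := dist_triangle_left x y o
  unfold gromovProduct; linarith

theorem gromovProduct_le_dist_left (o x y : X) : gromovProduct o x y ≤ dist o x := by
  have := dist_triangle o x y
  unfold gromovProduct; linarith

theorem gromovProduct_le_dist_right (o x y : X) : gromovProduct o x y ≤ dist o y := by
  rw [gromovProduct_comm]; exact gromovProduct_le_dist_left o y x

theorem gromovProduct_le_add_dist (o o' x y : X) :
    gromovProduct o x y ≤ gromovProduct o' x y + dist o o' := by
  have h1 := dist_triangle o o' x
  have h2 := dist_triangle o o' y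
  unfold gromovProduct; linarith

/-- The effect of moving the base point of a Gromov product from `o` to `z`. -/
theorem gromovProduct_change_base (o z x y : X) :
    gromovProduct z x y =
      dist o z + gromovProduct o x y - gromovProduct o z x - gromovProduct o z y := by
  simp only [gromovProduct, dist_comm z x, dist_comm z y]; ring

theorem tendsto_gromovProduct_base {ι : Type*} {l : Filter ι} {u v : ι → X} (o : X)
    (h : Tendsto (fun i => gromovProduct o (u i) (v i)) l atTop) (o' : X) :
    Tendsto (fun i => gromovProduct o' (u i) (v i)) l atTop := by
  refine tendsto_atTop_mono (fun i => ?_) (tendsto_atTop_add_const_right l (-dist o o') h)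
  have := gromovProduct_le_add_dist o o' (u i) (v i)
  linarith

theorem tendsto_gromovProduct_diag {o : X} {u v : ℕ → X}
    (h : Tendsto (fun p : ℕ × ℕ => gromovProduct o (u p.1) (v p.2)) atTop atTop) :
    Tendsto (fun n => gromovProduct o (u n) (v n)) atTop atTop :=
  h.comp tendsto_atTop_diagonal

variable [IsGromovHyperbolic X]

variable (X) in
/-- A non-negative constant for which the four-point condition holds in `X`. -/
noncomputable def hypConst : ℝ :=
  max 0 (IsGromovHyperbolic.exists_delta (X := X)).choose

variable (X) in
theorem hypConst_nonneg : 0 ≤ hypConst X := le_max_left _ _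

theorem gromovProduct_trans {o x y z : X} {r : ℝ} (h₁ : r ≤ gromovProduct o x y)
    (h₂ : r ≤ gromovProduct o y z) : r - hypConst X ≤ gromovProduct o x z := by
  have h := (IsGromovHyperbolic.exists_delta (X := X)).choose_spec o x y z
  have h' : (IsGromovHyperbolic.exists_delta (X := X)).choose ≤ hypConst X := le_max_right _ _
  have h'' := le_min h₁ h₂
  linarith

theorem gromovProduct_trans₃ {o x y z w : X} {r : ℝ} (h₁ : r ≤ gromovProduct o x y)
    (h₂ : r ≤ gromovProduct o y z) (h₃ : r ≤ gromovProduct o z w) :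
    r - 2 * hypConst X ≤ gromovProduct o x w := by
  have h₄ := gromovProduct_trans h₁ h₂
  have h₅ : r - hypConst X ≤ gromovProduct o z w := by linarith [hypConst_nonneg X]
  have := gromovProduct_trans h₄ h₅
  linarith

/-- The sequence `u` converges to the boundary point `ξ`, i.e. it represents `ξ`. -/
def TendsToBoundary (u : ℕ → X) (ξ : GromovBoundary X) : Prop :=
  ∃ hu : ConvergesToInfinity u, (Quotient.mk (seqSetoid X) ⟨u, hu⟩ : GromovBoundary X) = ξ

theorem exists_tendsToBoundary (ξ : GromovBoundary X) : ∃ u : ℕ → X, TendsToBoundary u ξ := by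
  induction ξ using Quotient.inductionOn with
  | h u => exact ⟨u.1, u.2, rfl⟩

theorem TendsToBoundary.tendsto {u v : ℕ → X} {ξ : GromovBoundary X} (hu : TendsToBoundary u ξ)
    (hv : TendsToBoundary v ξ) (o : X) :
    Tendsto (fun p : ℕ × ℕ => gromovProduct o (u p.1) (v p.2)) atTop atTop := by
  obtain ⟨hu, rfl⟩ := hu
  obtain ⟨hv, h⟩ := hv
  have huv : Tendsto (fun n => gromovProduct o (v n) (u n)) atTop atTop := Quotient.exact h o
  rw [tendsto_atTop]
  intro b
  have h1 := tendsto_atTop.1 huv (b + hypConst X)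
  have h2 := tendsto_atTop.1 (hu o) (b + hypConst X)
  have h3 := (tendsto_snd (α := ℕ) (β := ℕ) (f := atTop) (g := atTop)).eventually h1
  rw [← prod_atTop_atTop_eq] at h2 ⊢
  filter_upwards [h2, h3] with p h2 h3
  rw [gromovProduct_comm] at h3
  have := gromovProduct_trans h2 h3
  linarith

theorem TendsToBoundary.tendsto_diag {u v : ℕ → X} {ξ : GromovBoundary X}
    (hu : TendsToBoundary u ξ) (hv : TendsToBoundary v ξ) (o : X) :
    Tendsto (fun n => gromovProduct o (u n) (v n)) atTop atTop :=
  tendsto_gromovProduct_diag (hu.tendsto hv o)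

/-- A sequence which stays close, as seen from `o`, to a sequence converging to `ξ` converges
to `ξ`. -/
theorem TendsToBoundary.of_tendsto {u v : ℕ → X} {ξ : GromovBoundary X}
    (hu : TendsToBoundary u ξ) (o : X)
    (h : Tendsto (fun n => gromovProduct o (u n) (v n)) atTop atTop) : TendsToBoundary v ξ := by
  have hv : ConvergesToInfinity v := by
    intro o'
    refine tendsto_gromovProduct_base o ?_ o'
    rw [tendsto_atTop]
    intro b
    have h1 := tendsto_atTop.1 h (b + 2 * hypConst X)
    have h2 := tendsto_atTop.1 (hu.tendsto hu o) (b + 2 * hypConst X)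
    have h3 := (tendsto_fst (α := ℕ) (β := ℕ) (f := atTop) (g := atTop)).eventually h1
    have h4 := (tendsto_snd (α := ℕ) (β := ℕ) (f := atTop) (g := atTop)).eventually h1
    rw [← prod_atTop_atTop_eq] at h2 ⊢
    filter_upwards [h2, h3, h4] with p h2 h3 h4
    rw [gromovProduct_comm] at h3
    have := gromovProduct_trans₃ h3 h2 h4
    linarith
  obtain ⟨hu, rfl⟩ := hu
  refine ⟨hv, Quotient.sound fun o' => ?_⟩
  refine (tendsto_gromovProduct_base o h o').congr fun n => gromovProduct_comm _ _ _

theorem TendsToBoundary.unique {u : ℕ → X} {ξ η : GromovBoundary X}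
    (hu : TendsToBoundary u ξ) (hv : TendsToBoundary u η) : ξ = η := by
  obtain ⟨_, rfl⟩ := hu
  obtain ⟨_, rfl⟩ := hv
  rfl

theorem TendsToBoundary.eq_of_tendsto {u v : ℕ → X} {ξ η : GromovBoundary X}
    (hu : TendsToBoundary u ξ) (hv : TendsToBoundary v η) (o : X)
    (h : Tendsto (fun n => gromovProduct o (u n) (v n)) atTop atTop) : ξ = η :=
  (hu.of_tendsto o h).unique hv

/-- The Gromov products of sequences converging to different boundary points stay bounded. -/
theorem TendsToBoundary.eventually_le_of_ne {u v : ℕ → X} {ξ η : GromovBoundary X}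
    (hu : TendsToBoundary u ξ) (hv : TendsToBoundary v η) (hne : ξ ≠ η) (o : X) :
    ∃ K, ∀ᶠ p : ℕ × ℕ in atTop, gromovProduct o (u p.1) (v p.2) ≤ K := by
  by_contra! hcon
  refine hne (hu.eq_of_tendsto hv o ?_)
  rw [tendsto_atTop]
  intro b
  have hf := hcon (b + 2 * hypConst X)
  obtain ⟨N, hN⟩ := eventually_atTop.1 (tendsto_atTop.1 (hu.tendsto hu o) (b + 2 * hypConst X))
  obtain ⟨M, hM⟩ := eventually_atTop.1 (tendsto_atTop.1 (hv.tendsto hv o) (b + 2 * hypConst X))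
  obtain ⟨p, hp, hp'⟩ := (hf.and_eventually (eventually_ge_atTop (N.2, M.1))).exists
  filter_upwards [eventually_ge_atTop N.1, eventually_ge_atTop M.2] with n hn hm
  have := gromovProduct_trans₃ (hN (n, p.1) ⟨hn, hp'.1⟩) hp.le (hM (p.2, n) ⟨hp'.2, hm⟩)
  linarith

theorem TendsToBoundary.smul {Γ : Type*} [Group Γ] [MulAction Γ X] [IsIsometricSMul Γ X]
    {u : ℕ → X} {ξ : GromovBoundary X} (hu : TendsToBoundary u ξ) (g : Γ) :
    TendsToBoundary (fun n => g • u n) (g • ξ) := by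
  obtain ⟨hu, rfl⟩ := hu
  let w : SeqToInfinity X := ⟨u, hu⟩
  exact ⟨(g • w).2, rfl⟩

theorem TendsToBoundary.dist_tendsto {u : ℕ → X} {ξ : GromovBoundary X}
    (hu : TendsToBoundary u ξ) (o : X) : Tendsto (fun n => dist o (u n)) atTop atTop :=
  tendsto_atTop_mono (fun _ => gromovProduct_le_dist_left o _ _) (hu.tendsto_diag hu o)

end GromovProduct

/-! ### The topology of the Gromov boundary -/

section BoundaryTopology

variable {X : Type*} [MetricSpace X] [IsGromovHyperbolic X]

theorem le_boundaryProduct {o : X} {ξ η : GromovBoundary X} {u v : ℕ → X} {r : ℝ}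
    (hu : TendsToBoundary u ξ) (hv : TendsToBoundary v η)
    (h : ∀ᶠ n in atTop, r ≤ gromovProduct o (u n) (v n)) :
    (r : EReal) ≤ boundaryProduct o ξ η := by
  obtain ⟨hu, rfl⟩ := hu
  obtain ⟨hv, rfl⟩ := hv
  refine le_iSup_of_le ⟨u, hu⟩ (le_iSup_of_le ⟨v, hv⟩ (le_iSup_of_le rfl (le_iSup_of_le rfl ?_)))
  refine le_liminf_of_le (by isBoundedDefault) ?_
  filter_upwards [h] with n hn using EReal.coe_le_coe_iff.2 hn

/-- All sequences representing two boundary points compute their Gromov product up to a bounded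
error. -/
theorem eventually_le_of_le_boundaryProduct {o : X} {ξ η : GromovBoundary X} {u v : ℕ → X} {r : ℝ}
    (hu : TendsToBoundary u ξ) (hv : TendsToBoundary v η)
    (h : (r : EReal) ≤ boundaryProduct o ξ η) :
    ∀ᶠ p : ℕ × ℕ in atTop, r - 1 - 2 * hypConst X ≤ gromovProduct o (u p.1) (v p.2) := by
  have hlt : ((r - 1 : ℝ) : EReal) < boundaryProduct o ξ η :=
    lt_of_lt_of_le (EReal.coe_lt_coe_iff.2 (by linarith)) h
  simp only [boundaryProduct, lt_iSup_iff] at hlt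
  obtain ⟨u', v', hu', hv', hlt⟩ := hlt
  have h1 := eventually_lt_of_lt_liminf hlt (by isBoundedDefault)
  obtain ⟨A, hA⟩ := eventually_atTop.1
    (tendsto_atTop.1 (hu.tendsto (v := u'.1) ⟨u'.2, hu'⟩ o) (r - 1))
  obtain ⟨B, hB⟩ := eventually_atTop.1
    (tendsto_atTop.1 (TendsToBoundary.tendsto (u := v'.1) ⟨v'.2, hv'⟩ hv o) (r - 1))
  obtain ⟨k, hk, hkA, hkB⟩ :=
    (h1.and ((eventually_ge_atTop A.2).and (eventually_ge_atTop B.1))).exists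
  filter_upwards [eventually_ge_atTop (A.1, B.2)] with p hp
  exact gromovProduct_trans₃ (hA (p.1, k) ⟨hp.1, hkA⟩) (EReal.coe_lt_coe_iff.1 hk).le
    (hB (k, p.2) ⟨hkB, hp.2⟩)

theorem eventually_diag_of_le_boundaryProduct {o : X} {ξ η : GromovBoundary X} {u v : ℕ → X}
    {r : ℝ} (hu : TendsToBoundary u ξ) (hv : TendsToBoundary v η)
    (h : (r : EReal) ≤ boundaryProduct o ξ η) :
    ∀ᶠ n in atTop, r - 1 - 2 * hypConst X ≤ gromovProduct o (u n) (v n) :=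
  tendsto_atTop_diagonal.eventually (eventually_le_of_le_boundaryProduct hu hv h)

theorem self_mem_boundaryNhd (o : X) (ξ : GromovBoundary X) (r : ℝ) : ξ ∈ boundaryNhd o ξ r := by
  obtain ⟨u, hu⟩ := exists_tendsToBoundary ξ
  exact le_boundaryProduct hu hu (tendsto_atTop.1 (hu.tendsto_diag hu o) r)

theorem boundaryNhd_trans {o : X} {ξ η ζ : GromovBoundary X} {r : ℝ}
    (h₁ : η ∈ boundaryNhd o ξ (r + (1 + 3 * hypConst X)))
    (h₂ : ζ ∈ boundaryNhd o η (r + (1 + 3 * hypConst X))) : ζ ∈ boundaryNhd o ξ r := by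
  obtain ⟨u, hu⟩ := exists_tendsToBoundary ξ
  obtain ⟨v, hv⟩ := exists_tendsToBoundary η
  obtain ⟨w, hw⟩ := exists_tendsToBoundary ζ
  refine le_boundaryProduct hu hw ?_
  filter_upwards [eventually_diag_of_le_boundaryProduct hu hv h₁,
    eventually_diag_of_le_boundaryProduct hv hw h₂] with n hn hn'
  have := gromovProduct_trans hn hn'
  linarith

theorem boundaryNhd_base (o o' : X) (ξ : GromovBoundary X) (r : ℝ) :
    boundaryNhd o' ξ (r + (1 + 2 * hypConst X) + dist o' o) ⊆ boundaryNhd o ξ r := by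
  intro η hη
  obtain ⟨u, hu⟩ := exists_tendsToBoundary ξ
  obtain ⟨v, hv⟩ := exists_tendsToBoundary η
  refine le_boundaryProduct hu hv ?_
  filter_upwards [eventually_diag_of_le_boundaryProduct hu hv hη] with n hn
  have := gromovProduct_le_add_dist o' o (u n) (v n)
  linarith

theorem boundaryNhd_mem_nhds (o : X) (ξ : GromovBoundary X) (r : ℝ) :
    boundaryNhd o ξ r ∈ 𝓝 ξ := by
  -- the set of points which have a basic neighbourhood inside `boundaryNhd o ξ r` is open
  refine mem_nhds_iff.2 ⟨{η | ∃ s, boundaryNhd o η s ⊆ boundaryNhd o ξ r},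
    fun η ⟨s, hs⟩ => hs (self_mem_boundaryNhd o η s), ?_, ⟨r, Subset.rfl⟩⟩
  rintro o' η ⟨s, hs⟩
  refine ⟨(s + (1 + 3 * hypConst X)) + (1 + 2 * hypConst X) + dist o' o, fun η' hη' => ?_⟩
  exact ⟨s + (1 + 3 * hypConst X), fun ζ hζ =>
    hs (boundaryNhd_trans (boundaryNhd_base o o' η _ hη') hζ)⟩

theorem exists_boundaryNhd_subset (o : X) {ξ : GromovBoundary X} {V : Set (GromovBoundary X)}
    (hV : V ∈ 𝓝 ξ) : ∃ r : ℝ, boundaryNhd o ξ r ⊆ V := by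
  obtain ⟨W, hWV, hW, hξ⟩ := mem_nhds_iff.1 hV
  obtain ⟨r, hr⟩ := hW o ξ hξ
  exact ⟨r, hr.trans hWV⟩

instance [Nonempty X] : T2Space (GromovBoundary X) := by
  refine ⟨fun ξ η hne => ?_⟩
  obtain ⟨o⟩ := ‹Nonempty X›
  obtain ⟨u, hu⟩ := exists_tendsToBoundary ξ
  obtain ⟨v, hv⟩ := exists_tendsToBoundary η
  obtain ⟨K, hK⟩ := hu.eventually_le_of_ne hv hne o
  let r := K + 2 + 3 * hypConst X
  obtain ⟨V, hV, hVo, hξ⟩ := mem_nhds_iff.1 (boundaryNhd_mem_nhds o ξ r)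
  obtain ⟨W, hW, hWo, hη⟩ := mem_nhds_iff.1 (boundaryNhd_mem_nhds o η r)
  refine ⟨V, W, hVo, hWo, hξ, hη, Set.disjoint_left.2 fun ζ h1 h2 => ?_⟩
  obtain ⟨w, hw⟩ := exists_tendsToBoundary ζ
  obtain ⟨n, h1, h2, h3⟩ := ((eventually_diag_of_le_boundaryProduct hu hw (hV h1)).and
    ((eventually_diag_of_le_boundaryProduct hv hw (hW h2)).and
      (tendsto_atTop_diagonal.eventually hK))).exists
  rw [gromovProduct_comm] at h2
  have := gromovProduct_trans h1 h2
  simp only [r] at this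
  linarith

/-- The shadow of the point `w` as seen from `o`: the boundary points whose Gromov product with
`w` is at least `q`. Some sequence representing the boundary point is used, since different ones
give different values. -/
def shadow (o w : X) (q : ℝ) : Set (GromovBoundary X) :=
  {η | ∃ v, TendsToBoundary v η ∧ ∀ᶠ n in atTop, q ≤ gromovProduct o w (v n)}

theorem exists_shadow_subset (o : X) {ξ : GromovBoundary X} {V : Set (GromovBoundary X)}
    (hV : V ∈ 𝓝 ξ) {u : ℕ → X} (hu : TendsToBoundary u ξ) :
    ∃ q : ℕ, ∀ w, (∀ᶠ n in atTop, (q : ℝ) ≤ gromovProduct o w (u n)) → shadow o w q ⊆ V := by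
  obtain ⟨r, hr⟩ := exists_boundaryNhd_subset o hV
  obtain ⟨q, hq⟩ := exists_nat_ge (r + hypConst X)
  refine ⟨q, fun w hw η ⟨v, hv, hv'⟩ => hr (le_boundaryProduct hu hv ?_)⟩
  filter_upwards [hw, hv'] with n h1 h2
  rw [gromovProduct_comm] at h1
  have := gromovProduct_trans h1 h2
  linarith

theorem shadow_mem_nhds {o w : X} {q : ℝ} {ξ : GromovBoundary X} {u : ℕ → X}
    (hu : TendsToBoundary u ξ)
    (hw : ∀ᶠ n in atTop, q + hypConst X ≤ gromovProduct o w (u n)) : shadow o w q ∈ 𝓝 ξ := by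
  refine mem_of_superset (boundaryNhd_mem_nhds o ξ (q + (1 + 3 * hypConst X))) fun η hη => ?_
  obtain ⟨v, hv⟩ := exists_tendsToBoundary η
  refine ⟨v, hv, ?_⟩
  filter_upwards [hw, eventually_diag_of_le_boundaryProduct hu hv hη] with n h1 h2
  have h3 : q + hypConst X ≤ gromovProduct o (u n) (v n) := by linarith
  have := gromovProduct_trans h1 h3
  linarith

instance [Nonempty X] [TopologicalSpace.SeparableSpace X] :
    SecondCountableTopology (GromovBoundary X) := by
  obtain ⟨o⟩ := ‹Nonempty X›
  obtain ⟨D, hDc, hD⟩ := TopologicalSpace.exists_countable_dense X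
  have hb : TopologicalSpace.IsTopologicalBasis
      ((fun p : X × ℕ => interior (shadow o p.1 p.2)) '' (D ×ˢ univ)) := by
    refine TopologicalSpace.isTopologicalBasis_of_isOpen_of_nhds ?_ ?_
    · rintro _ ⟨p, -, rfl⟩
      exact isOpen_interior
    · intro ξ V hξ hV
      obtain ⟨u, hu⟩ := exists_tendsToBoundary ξ
      obtain ⟨q, hq⟩ := exists_shadow_subset o (hV.mem_nhds hξ) hu
      obtain ⟨N, hN⟩ := eventually_atTop.1
        (tendsto_atTop.1 (hu.tendsto hu o) (q + hypConst X + 1))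
      obtain ⟨w, hwD, hw⟩ := hD.exists_dist_lt (u N.1) one_pos
      have hwu : ∀ᶠ n in atTop, (q : ℝ) + hypConst X ≤ gromovProduct o w (u n) := by
        filter_upwards [eventually_ge_atTop N.2] with n hn
        have h1 := hN (N.1, n) ⟨le_rfl, hn⟩
        have h2 := dist_triangle o w (u N.1)
        have h3 := dist_triangle w (u N.1) (u n)
        rw [dist_comm] at hw
        simp only [gromovProduct] at h1 ⊢
        linarith
      refine ⟨_, ⟨(w, q), ⟨hwD, mem_univ _⟩, rfl⟩, mem_interior_iff_mem_nhds.2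
        (shadow_mem_nhds hu hwu), interior_subset.trans (hq w ?_)⟩
      filter_upwards [hwu] with n hn
      linarith [hypConst_nonneg X]
  exact hb.secondCountableTopology ((hDc.prod countable_univ).image _)

end BoundaryTopology

/-! ### Averages of distance functions -/

section DistAverage

variable {X : Type*} [MetricSpace X] {Γ : Type*} [Group Γ] [MulAction Γ X]

/-- `h` is, up to an additive constant, a pointwise limit of convex combinations of the functions
`a ↦ d(k • o, a • o)` on `Γ`, `k ∈ Γ`. This is encoded by duality: every affine inequality between
differences of values which holds for all these functions holds for `h`. -/
def IsDistAverage (o : X) (h : Γ → ℝ) : Prop :=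
  ∀ (n : ℕ) (a : Fin n → Γ) (w : Fin n → ℝ) (c : ℝ), ∑ i, w i = 0 →
    (∀ k : Γ, ∑ i, w i * dist (k • o) (a i • o) ≤ c) → ∑ i, w i * h (a i) ≤ c

/-- The boundary points which are limits of sequences `a n • o` along which `h` is bounded
above. -/
def sublevelLimits [IsGromovHyperbolic X] (o : X) (h : Γ → ℝ) : Set (GromovBoundary X) :=
  {ξ | ∃ r : ℝ, ∃ a : ℕ → Γ, (∀ n, h (a n) ≤ r) ∧ TendsToBoundary (fun n => a n • o) ξ}

/-- `ξ` is the limit of all sequences `a n • o` along which `h` tends to `-∞`. -/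
def IsPole [IsGromovHyperbolic X] (o : X) (h : Γ → ℝ) (ξ : GromovBoundary X) : Prop :=
  ∀ a : ℕ → Γ, Tendsto (fun n => h (a n)) atTop atBot → TendsToBoundary (fun n => a n • o) ξ

variable {o : X} {h : Γ → ℝ}

theorem IsDistAverage.sub_const (hh : IsDistAverage o h) (c : ℝ) :
    IsDistAverage o fun a => h a - c := by
  intro n a w d hw hd
  have := hh n a w d hw hd
  simpa only [mul_sub, Finset.sum_sub_distrib, ← Finset.sum_mul, hw, zero_mul, sub_zero] using this

theorem IsDistAverage.sub_le_dist (hh : IsDistAverage o h) (a b : Γ) :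
    h a - h b ≤ dist (a • o) (b • o) := by
  have := hh 2 ![a, b] ![1, -1] (dist (a • o) (b • o)) (by simp) (fun k => by
    simp only [Fin.sum_univ_two, Matrix.cons_val_zero, Matrix.cons_val_one]
    have := dist_triangle_right (k • o) (a • o) (b • o)
    have := dist_triangle (k • o) (b • o) (a • o)
    rw [dist_comm (b • o)] at this
    linarith)
  simp only [Fin.sum_univ_two, Matrix.cons_val_zero, Matrix.cons_val_one] at this
  linarith

theorem exists_tendsto_atBot {ι : Type*} {h : ι → ℝ} (hb : ¬ BddBelow (range h)) :
    ∃ a : ℕ → ι, Tendsto (fun n => h (a n)) atTop atBot := by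
  have : ∀ n : ℕ, ∃ a, h a < -n := fun n => by
    by_contra! hcon
    exact hb ⟨-n, by rintro _ ⟨a, rfl⟩; exact hcon a⟩
  choose a ha using this
  exact ⟨a, tendsto_atBot_mono (fun n => (ha n).le)
    (tendsto_neg_atTop_atBot.comp tendsto_natCast_atTop_atTop)⟩

variable [IsGromovHyperbolic X]

theorem IsPole.unique {ξ η : GromovBoundary X} (hb : ¬ BddBelow (range h)) (hξ : IsPole o h ξ)
    (hη : IsPole o h η) : ξ = η := by
  obtain ⟨a, ha⟩ := exists_tendsto_atBot hb
  exact (hξ a ha).unique (hη a ha)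

/-- Distance functions in a hyperbolic space are quasi-convex, and so are their averages. The
Gromov product of `a` and `b` based at `p` plays the role of the distance from `p` to a geodesic
joining them. -/
theorem IsDistAverage.le_max (hh : IsDistAverage o h) (p a b : Γ) :
    h p ≤ max (h a) (h b) + gromovProduct (p • o) (a • o) (b • o) + 2 * hypConst X := by
  -- `t` is the relative position on `[a, b]` of the projection of `p`
  obtain ⟨t, ht0, ht1, ht, ht'⟩ : ∃ t : ℝ, 0 ≤ t ∧ t ≤ 1 ∧
      t * dist (a • o) (b • o) = gromovProduct (a • o) (p • o) (b • o) ∧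
      (1 - t) * dist (a • o) (b • o) = gromovProduct (b • o) (p • o) (a • o) := by
    have hsum : gromovProduct (a • o) (p • o) (b • o) + gromovProduct (b • o) (p • o) (a • o)
        = dist (a • o) (b • o) := by
      simp only [gromovProduct, dist_comm (p • o), dist_comm (b • o) (a • o)]; ring
    have h1 := gromovProduct_nonneg (a • o) (p • o) (b • o)
    have h2 := gromovProduct_nonneg (b • o) (p • o) (a • o)
    rcases (dist_nonneg (x := a • o) (y := b • o)).eq_or_lt with h0 | h0
    · exact ⟨0, le_rfl, zero_le_one, by rw [zero_mul]; linarith, by rw [← h0]; linarith⟩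
    · have h3 : gromovProduct (a • o) (p • o) (b • o) / dist (a • o) (b • o) * dist (a • o) (b • o)
          = gromovProduct (a • o) (p • o) (b • o) := div_mul_cancel₀ _ h0.ne'
      refine ⟨gromovProduct (a • o) (p • o) (b • o) / dist (a • o) (b • o), by positivity,
        (div_le_one h0).2 (by linarith), h3, by rw [sub_mul, h3]; linarith⟩
  have key : ∀ k : Γ, dist (k • o) (p • o) ≤ (1 - t) * dist (k • o) (a • o)
      + t * dist (k • o) (b • o) + gromovProduct (p • o) (a • o) (b • o) + 2 * hypConst X := by
    intro k
    have hδ : min (gromovProduct (p • o) (a • o) (k • o)) (gromovProduct (p • o) (k • o) (b • o))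
        - hypConst X ≤ gromovProduct (p • o) (a • o) (b • o) :=
      gromovProduct_trans (min_le_left _ _) (min_le_right _ _)
    have h1 := dist_triangle (k • o) (b • o) (a • o)
    have h2 := dist_triangle (k • o) (a • o) (b • o)
    rw [dist_comm (b • o) (a • o)] at h1
    rcases min_choice (gromovProduct (p • o) (a • o) (k • o))
      (gromovProduct (p • o) (k • o) (b • o)) with h3 | h3
    · have h4 : t * (dist (k • o) (a • o) - dist (k • o) (b • o)) ≤ t * dist (a • o) (b • o) :=
        mul_le_mul_of_nonneg_left (by linarith) ht0
      rw [h3] at hδ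
      rw [ht] at h4
      simp only [gromovProduct, dist_comm (a • o) (p • o), dist_comm (a • o) (k • o),
        dist_comm (p • o) (k • o)] at hδ h4 ⊢
      linarith
    · have h4 : (1 - t) * (dist (k • o) (b • o) - dist (k • o) (a • o))
          ≤ (1 - t) * dist (a • o) (b • o) :=
        mul_le_mul_of_nonneg_left (by linarith) (by linarith)
      rw [h3] at hδ
      rw [ht'] at h4
      simp only [gromovProduct, dist_comm (b • o) (p • o), dist_comm (p • o) (k • o),
        dist_comm (b • o) (a • o)] at hδ h4 ⊢
      linarith
  have := hh 3 ![p, a, b] ![1, -(1 - t), -t]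
    (gromovProduct (p • o) (a • o) (b • o) + 2 * hypConst X)
    (by simp [Fin.sum_univ_three]) (fun k => by
      simp only [Fin.sum_univ_three, Matrix.cons_val_zero, Matrix.cons_val_one, Matrix.cons_val]
      linarith [key k])
  simp only [Fin.sum_univ_three, Matrix.cons_val_zero, Matrix.cons_val_one, Matrix.cons_val] at this
  have h1 : (1 - t) * h a ≤ (1 - t) * max (h a) (h b) :=
    mul_le_mul_of_nonneg_left (le_max_left _ _) (by linarith)
  have h2 : t * h b ≤ t * max (h a) (h b) := mul_le_mul_of_nonneg_left (le_max_right _ _) ht0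
  linarith

/-- An average of distance functions cannot be bounded at the three ends of a long tripod whose
centre is close to `o`: a distance function grows at unit speed along at least two of the legs
and decreases at most at unit speed along the third. -/
theorem IsDistAverage.tripod (hh : IsDistAverage o h) {a : Fin 3 → Γ} {κ s ℓ : ℝ} (hκ : 0 ≤ κ)
    (hs : 0 ≤ s) (hℓ : 0 < ℓ) (hdist : ∀ i, ℓ ≤ dist o (a i • o))
    (hprod : ∀ i j, i ≠ j → gromovProduct o (a i • o) (a j • o) ≤ κ)
    (hle : ∀ i, h (a i) ≤ h 1 + s) : ℓ ≤ 3 * s + 4 * (κ + hypConst X) := by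
  have hδ := hypConst_nonneg X
  have hpos : ∀ i, 0 < dist o (a i • o) := fun i => hℓ.trans_le (hdist i)
  -- the Gromov products of a fixed point with the ends of the legs, relative to their lengths
  have hone : ∀ (k : Γ) (i : Fin 3),
      gromovProduct o (k • o) (a i • o) / dist o (a i • o) ≤ 1 := fun k i =>
    (div_le_one (hpos i)).2 (gromovProduct_le_dist_right _ _ _)
  have hsmall : ∀ (k : Γ) (i : Fin 3), gromovProduct o (k • o) (a i • o) ≤ κ + hypConst X →
      gromovProduct o (k • o) (a i • o) / dist o (a i • o) ≤ (κ + hypConst X) / ℓ := fun k i hi =>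
    div_le_div₀ (by positivity) hi hℓ (hdist i)
  have hbig : ∀ (k : Γ) (i j : Fin 3), i ≠ j → gromovProduct o (k • o) (a i • o) ≤ κ + hypConst X ∨
      gromovProduct o (k • o) (a j • o) ≤ κ + hypConst X := by
    intro k i j hij
    by_contra! hcon
    have h1 := lt_min hcon.1 hcon.2
    have h2 : min (gromovProduct o (k • o) (a i • o)) (gromovProduct o (k • o) (a j • o))
        - hypConst X ≤ gromovProduct o (a i • o) (a j • o) :=
      gromovProduct_trans (by rw [gromovProduct_comm]; exact min_le_left _ _) (min_le_right _ _)
    linarith [hprod i j hij]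
  have hsum : ∀ k : Γ, ∑ i, gromovProduct o (k • o) (a i • o) / dist o (a i • o)
      ≤ 1 + 2 * ((κ + hypConst X) / ℓ) := by
    intro k
    rw [Fin.sum_univ_three]
    have h01 := hbig k 0 1 (by decide)
    have h02 := hbig k 0 2 (by decide)
    have h12 := hbig k 1 2 (by decide)
    have hp : 0 ≤ (κ + hypConst X) / ℓ := by positivity
    rcases h01 with h0 | h1
    · rcases h12 with h1 | h2
      · linarith [hsmall k 0 h0, hsmall k 1 h1, hone k 2]
      · linarith [hsmall k 0 h0, hsmall k 2 h2, hone k 1]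
    · rcases h02 with h0 | h2
      · linarith [hsmall k 0 h0, hsmall k 1 h1, hone k 2]
      · linarith [hsmall k 1 h1, hsmall k 2 h2, hone k 0]
  have hbusemann : ∀ (k : Γ) (i : Fin 3), (dist o (a i • o))⁻¹ *
      (dist (k • o) ((1 : Γ) • o) - dist (k • o) (a i • o))
      = 2 * (gromovProduct o (k • o) (a i • o) / dist o (a i • o)) - 1 := by
    intro k i
    have := (hpos i).ne'
    rw [one_smul, gromovProduct, dist_comm (k • o) o]
    field_simp
    ring
  have := hh 4 ![1, a 0, a 1, a 2]
    ![(dist o (a 0 • o))⁻¹ + (dist o (a 1 • o))⁻¹ + (dist o (a 2 • o))⁻¹,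
      -(dist o (a 0 • o))⁻¹, -(dist o (a 1 • o))⁻¹, -(dist o (a 2 • o))⁻¹]
    (2 * (1 + 2 * ((κ + hypConst X) / ℓ)) - 3) (by simp [Fin.sum_univ_four]; ring) (fun k => by
      have h1 := hsum k
      simp only [Fin.sum_univ_three] at h1
      simp only [Fin.sum_univ_four, Matrix.cons_val_zero, Matrix.cons_val_one, Matrix.cons_val]
      linarith [hbusemann k 0, hbusemann k 1, hbusemann k 2])
  simp only [Fin.sum_univ_four, Matrix.cons_val_zero, Matrix.cons_val_one, Matrix.cons_val] at this
  have hlow : ∀ i, -(s / ℓ) ≤ (dist o (a i • o))⁻¹ * (h 1 - h (a i)) := by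
    intro i
    have h1 : (dist o (a i • o))⁻¹ * (h (a i) - h 1) ≤ (dist o (a i • o))⁻¹ * s :=
      mul_le_mul_of_nonneg_left (by linarith [hle i]) (inv_nonneg.2 (hpos i).le)
    have h2 : (dist o (a i • o))⁻¹ * s ≤ s / ℓ := by
      rw [div_eq_inv_mul]
      exact mul_le_mul_of_nonneg_right (inv_anti₀ hℓ (hdist i)) hs
    linarith
  have h3 : 1 ≤ (3 * s + 4 * (κ + hypConst X)) / ℓ := by
    have : (3 * s + 4 * (κ + hypConst X)) / ℓ = 3 * (s / ℓ) + 4 * ((κ + hypConst X) / ℓ) := by ring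
    linarith [hlow 0, hlow 1, hlow 2]
  rwa [one_le_div hℓ] at h3

/-- Sublevel sets of an average of distance functions have at most two limit points. -/
theorem IsDistAverage.tendsToBoundary_unique₃ (hh : IsDistAverage o h)
    {ξ : Fin 3 → GromovBoundary X}
    (hξ : ∀ i, ξ i ∈ sublevelLimits o h) : ∃ i j, i ≠ j ∧ ξ i = ξ j := by
  by_contra! hne
  choose r a hr ha using hξ
  have hK : ∀ i j, i ≠ j → ∃ K, ∀ᶠ n in atTop, gromovProduct o (a i n • o) (a j n • o) ≤ K :=
    fun i j hij => by
      obtain ⟨K, hK⟩ := (ha i).eventually_le_of_ne (ha j) (hne i j hij) o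
      exact ⟨K, tendsto_atTop_diagonal.eventually hK⟩
  choose! K hK using hK
  obtain ⟨κ, hκ⟩ : ∃ κ, 0 ≤ κ ∧ ∀ i j, K i j ≤ κ := by
    obtain ⟨M, hM⟩ := (Set.finite_range fun p : Fin 3 × Fin 3 => K p.1 p.2).bddAbove
    exact ⟨max 0 M, le_max_left _ _, fun i j => (hM ⟨(i, j), rfl⟩).trans (le_max_right _ _)⟩
  obtain ⟨s, hs0, hs⟩ : ∃ s, 0 ≤ s ∧ ∀ i, r i - h 1 ≤ s := by
    obtain ⟨M, hM⟩ := (Set.finite_range fun i => r i - h 1).bddAbove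
    exact ⟨max 0 M, le_max_left _ _, fun i => (hM ⟨i, rfl⟩).trans (le_max_right _ _)⟩
  let ℓ := 3 * s + 4 * (κ + hypConst X) + 1
  have hev : ∀ᶠ n in atTop, (∀ i, ℓ ≤ dist o (a i n • o)) ∧
      ∀ i j, i ≠ j → gromovProduct o (a i n • o) (a j n • o) ≤ κ := by
    refine (eventually_all.2 fun i => tendsto_atTop.1 ((ha i).dist_tendsto o) ℓ).and
      (eventually_all.2 fun i => eventually_all.2 fun j => ?_)
    by_cases hij : i = j
    · exact Eventually.of_forall fun n h => absurd hij h
    · filter_upwards [hK i j hij] with n hn _ using hn.trans (hκ.2 i j)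
  obtain ⟨n, h1, h2⟩ := hev.exists
  have hδ := hypConst_nonneg X
  have hκ0 := hκ.1
  have := hh.tripod (a := fun i => a i n) hκ.1 hs0 (ℓ := ℓ) (by simp only [ℓ]; positivity) h1 h2
    fun i => by linarith [hr i n, hs i]
  simp only [ℓ] at this
  linarith

/-- Unbounded sequences of orbit points in a sublevel set of an average of distance functions
subconverge to boundary points. The space `X` is not assumed to be proper; compactness is replaced
by the absence of long tripods in sublevel sets. -/
theorem IsDistAverage.exists_subseq (hh : IsDistAverage o h) {a : ℕ → Γ} {r : ℝ}
    (hr : ∀ n, h (a n) ≤ r) (ha : Tendsto (fun n => dist o (a n • o)) atTop atTop) :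
    ∃ k : ℕ → ℕ, (∀ n, n ≤ k n) ∧ ∃ ξ, TendsToBoundary (fun n => a (k n) • o) ξ := by
  let U : Ultrafilter ℕ := hyperfilter ℕ
  have hU : (U : Filter ℕ) ≤ atTop := Nat.cofinite_eq_atTop ▸ hyperfilter_le_cofinite
  have hδ := hypConst_nonneg X
  -- otherwise `U` would contain the vertices of a long tripod
  have key : ∀ κ : ℝ, 0 ≤ κ → ∀ᶠ n in (U : Filter ℕ), ∀ᶠ m in (U : Filter ℕ),
      κ < gromovProduct o (a n • o) (a m • o) := by
    intro κ hκ
    by_contra hcon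
    rw [← Ultrafilter.eventually_not] at hcon
    have hN : ∀ᶠ n in (U : Filter ℕ), ∀ᶠ m in (U : Filter ℕ),
        gromovProduct o (a n • o) (a m • o) ≤ κ := by
      filter_upwards [hcon] with n hn
      rw [← Ultrafilter.eventually_not] at hn
      filter_upwards [hn] with m hm using not_lt.1 hm
    let s := max 0 (r - h 1)
    let ℓ := 3 * s + 4 * (κ + hypConst X) + 1
    have hs0 : 0 ≤ s := le_max_left _ _
    have hlong : ∀ᶠ n in (U : Filter ℕ), ℓ ≤ dist o (a n • o) := hU (tendsto_atTop.1 ha ℓ)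
    obtain ⟨n₀, h0, l0⟩ := (hN.and hlong).exists
    obtain ⟨n₁, h1, l1, h01⟩ := (hN.and (hlong.and h0)).exists
    obtain ⟨n₂, l2, h02, h12⟩ := (hlong.and (h0.and h1)).exists
    have := hh.tripod (a := ![a n₀, a n₁, a n₂]) hκ hs0 (ℓ := ℓ)
      (by simp only [ℓ]; positivity) (by simp [Fin.forall_fin_succ, l0, l1, l2])
      (by
        have h10 := h01
        have h20 := h02
        have h21 := h12
        rw [gromovProduct_comm] at h10 h20 h21
        simp [Fin.forall_fin_succ, h01, h02, h12, h10, h20, h21])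
      (by
        intro i
        have : r ≤ h 1 + s := by linarith [le_max_right 0 (r - h 1)]
        fin_cases i <;> exact (hr _).trans this)
    simp only [ℓ] at this
    linarith
  have hsel : ∀ k : ℕ, ∃ n, k ≤ n ∧ ∀ᶠ m in (U : Filter ℕ),
      (k : ℝ) < gromovProduct o (a n • o) (a m • o) := fun k => by
    have h1 : ∀ᶠ n in (U : Filter ℕ), k ≤ n := hU (eventually_ge_atTop k)
    exact (h1.and (key k k.cast_nonneg)).exists
  choose k hk hkU using hsel
  have hconv : ConvergesToInfinity fun n => a (k n) • o := by
    intro o'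
    refine tendsto_gromovProduct_base o ?_ o'
    rw [tendsto_atTop]
    intro b
    obtain ⟨N, hN⟩ := exists_nat_ge (b + hypConst X)
    filter_upwards [eventually_ge_atTop (N, N)] with p hp
    obtain ⟨m, h1, h2⟩ := ((hkU p.1).and (hkU p.2)).exists
    rw [gromovProduct_comm] at h2
    have h3 : (N : ℝ) ≤ p.1 := by exact_mod_cast hp.1
    have h4 : (N : ℝ) ≤ p.2 := by exact_mod_cast hp.2
    have := gromovProduct_trans (r := b + hypConst X) (by linarith) (h2.le.trans' (by linarith))
    linarith
  exact ⟨k, hk, _, hconv, rfl⟩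

/-- If two averages of distance functions have no common limit point, then their sublevel sets
diverge from each other. -/
theorem IsDistAverage.exists_le_of_disjoint {h' : Γ → ℝ} (hh : IsDistAverage o h)
    (hdisj : Disjoint (sublevelLimits o h) (sublevelLimits o h')) (r : ℝ) :
    ∃ K, ∀ a b : Γ, h a ≤ r → h' b ≤ r → gromovProduct o (a • o) (b • o) ≤ K := by
  by_contra! hcon
  choose a b ha hb hab using fun n : ℕ => hcon n
  have hdist : Tendsto (fun n => dist o (a n • o)) atTop atTop :=
    tendsto_atTop_mono (fun n => (hab n).le.trans (gromovProduct_le_dist_left _ _ _))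
      tendsto_natCast_atTop_atTop
  obtain ⟨k, hk, ξ, hξ⟩ := hh.exists_subseq ha hdist
  have hξ' : TendsToBoundary (fun n => b (k n) • o) ξ := by
    refine hξ.of_tendsto o ?_
    refine tendsto_atTop_mono (fun n => ?_) tendsto_natCast_atTop_atTop
    exact le_trans (by exact_mod_cast hk n) (hab (k n)).le
  exact Set.disjoint_left.1 hdisj ⟨r, _, fun n => ha (k n), hξ⟩
    ⟨r, _, fun n => hb (k n), hξ'⟩

theorem IsDistAverage.tendsto_gromovProduct (hh : IsDistAverage o h) {a b : ℕ → Γ}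
    (ha : Tendsto (fun n => h (a n)) atTop atBot) (hb : Tendsto (fun n => h (b n)) atTop atBot) :
    Tendsto (fun p : ℕ × ℕ => gromovProduct o (a p.1 • o) (b p.2 • o)) atTop atTop := by
  rw [tendsto_atTop]
  intro c
  obtain ⟨N, hN⟩ := eventually_atTop.1 (tendsto_atBot.1 ha (h 1 - 2 * hypConst X - c))
  obtain ⟨M, hM⟩ := eventually_atTop.1 (tendsto_atBot.1 hb (h 1 - 2 * hypConst X - c))
  filter_upwards [eventually_ge_atTop (N, M)] with p hp
  have h3 := hh.le_max 1 (a p.1) (b p.2)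
  have h4 := max_le (hN p.1 hp.1) (hM p.2 hp.2)
  rw [one_smul] at h3
  linarith

/-- An average of distance functions which is not bounded below has a pole. -/
theorem IsDistAverage.exists_isPole (hh : IsDistAverage o h) (hb : ¬ BddBelow (range h)) :
    ∃ ξ : GromovBoundary X, IsPole o h ξ := by
  obtain ⟨a, ha⟩ := exists_tendsto_atBot hb
  have hconv : ConvergesToInfinity fun n => a n • o := fun o' =>
    tendsto_gromovProduct_base o (hh.tendsto_gromovProduct ha ha) o'
  obtain ⟨ξ, hξ⟩ : ∃ ξ, TendsToBoundary (fun n => a n • o) ξ := ⟨_, hconv, rfl⟩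
  refine ⟨ξ, fun b hb => hξ.of_tendsto o ?_⟩
  exact tendsto_gromovProduct_diag (u := fun n => a n • o) (v := fun n => b n • o)
    (hh.tendsto_gromovProduct ha hb)

section Equivariance

variable [IsIsometricSMul Γ X] {h' : Γ → ℝ} {g : Γ}

theorem sublevelLimits_smul (heq : ∀ a b, h' (g * a) - h' (g * b) = h a - h b)
    {ξ : GromovBoundary X} (hξ : ξ ∈ sublevelLimits o h) : g • ξ ∈ sublevelLimits o h' := by
  obtain ⟨r, a, hr, ha⟩ := hξ
  refine ⟨r + h' (g * 1) - h 1, fun n => g * a n, fun n => ?_, ?_⟩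
  · linarith [heq (a n) 1, hr n]
  · simpa only [mul_smul] using ha.smul g

theorem IsPole.smul (heq : ∀ a b, h' (g * a) - h' (g * b) = h a - h b)
    {ξ : GromovBoundary X} (hξ : IsPole o h ξ) : IsPole o h' (g • ξ) := by
  intro b hb
  have h1 : Tendsto (fun n => h (g⁻¹ * b n)) atTop atBot := by
    refine (tendsto_atBot_add_const_right _ (h 1 - h' (g * 1)) hb).congr fun n => ?_
    have := heq (g⁻¹ * b n) 1
    rw [mul_inv_cancel_left] at this
    linarith
  simpa only [← mul_smul, mul_inv_cancel_left] using (hξ _ h1).smul g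

end Equivariance

end DistAverage

/-! ### Non-elementary actions -/

section NonElementary

variable {Γ : Type*} [Group Γ] {X : Type*} [MetricSpace X] [MulAction Γ X]
  [IsIsometricSMul Γ X] [IsGromovHyperbolic X]

variable (Γ X) in
/-- The action has no invariant non-empty bounded set, boundary point or pair of boundary points. -/
structure IsNonElementary : Prop where
  bounded : ¬ ∃ A : Set X, A.Nonempty ∧ Bornology.IsBounded A ∧
    ∀ g : Γ, (fun x => g • x) '' A = A
  point : ¬ ∃ ξ : GromovBoundary X, ∀ g : Γ, g • ξ = ξ
  pair : ¬ ∃ ξ η : GromovBoundary X, ξ ≠ η ∧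
    ∀ g : Γ, ({g • ξ, g • η} : Set (GromovBoundary X)) = {ξ, η}

/-- There is no non-empty invariant set of at most two boundary points. -/
theorem IsNonElementary.not_invariant (hne : IsNonElementary Γ X) {T : Set (GromovBoundary X)}
    (hT : T.Nonempty) (h₃ : ∀ ξ : Fin 3 → GromovBoundary X, (∀ i, ξ i ∈ T) →
      ∃ i j, i ≠ j ∧ ξ i = ξ j) (hinv : ∀ (g : Γ), ∀ ξ ∈ T, g • ξ ∈ T) : False := by
  obtain ⟨ξ, hξ⟩ := hT
  by_cases hall : ∀ η ∈ T, η = ξ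
  · exact hne.point ⟨ξ, fun g => hall _ (hinv g ξ hξ)⟩
  push Not at hall
  obtain ⟨η, hη, hηξ⟩ := hall
  have hT2 : ∀ ζ ∈ T, ζ = ξ ∨ ζ = η := by
    intro ζ hζ
    obtain ⟨i, j, hij, h⟩ := h₃ ![ξ, η, ζ] (by simp [Fin.forall_fin_succ, hξ, hη, hζ])
    fin_cases i <;> fin_cases j <;> simp_all
  refine hne.pair ⟨ξ, η, hηξ.symm, fun g => ?_⟩
  have hinj : g • ξ ≠ g • η := fun h => hηξ (MulAction.injective g h).symm
  rcases hT2 _ (hinv g ξ hξ) with h1 | h1 <;> rcases hT2 _ (hinv g η hη) with h2 | h2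
  · exact absurd (h1.trans h2.symm) hinj
  · rw [h1, h2]
  · rw [h1, h2, Set.pair_comm]
  · exact absurd (h1.trans h2.symm) hinj

/-- No average of distance functions is bounded above on the orbit: the limit set of `Γ` would be
contained in the limit set of a sublevel set, so it would have at most two points. -/
theorem IsNonElementary.not_bddAbove (hne : IsNonElementary Γ X) {o : X} {h : Γ → ℝ}
    (hh : IsDistAverage o h) : ¬ BddAbove (range h) := by
  rintro ⟨r, hr⟩
  have hr' : ∀ a, h a ≤ r := fun a => hr ⟨a, rfl⟩
  have hunb : ∀ n : ℕ, ∃ a : Γ, (n : ℝ) ≤ dist o (a • o) := by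
    by_contra! hcon
    obtain ⟨n, hn⟩ := hcon
    refine hne.bounded ⟨range fun a : Γ => a • o, ⟨_, 1, rfl⟩, ?_, fun g => ?_⟩
    · refine (Metric.isBounded_closedBall (x := o) (r := n)).subset ?_
      rintro _ ⟨a, rfl⟩
      rw [Metric.mem_closedBall, dist_comm]
      exact (hn a).le
    · ext x
      constructor
      · rintro ⟨_, ⟨a, rfl⟩, rfl⟩
        exact ⟨g * a, mul_smul g a o⟩
      · rintro ⟨a, rfl⟩
        exact ⟨_, ⟨g⁻¹ * a, rfl⟩, by simp only [mul_smul, smul_inv_smul]⟩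
  choose a ha using hunb
  obtain ⟨k, -, ξ, hξ⟩ := hh.exists_subseq (fun n => hr' (a n))
    (tendsto_atTop_mono ha tendsto_natCast_atTop_atTop)
  refine hne.not_invariant (T := {ξ | ∃ a : ℕ → Γ, TendsToBoundary (fun n => a n • o) ξ})
    ⟨ξ, _, hξ⟩ (fun ξ hξ => hh.tendsToBoundary_unique₃ fun i => ?_) fun g ξ ⟨a, ha⟩ => ?_
  · obtain ⟨a, ha⟩ := hξ i
    exact ⟨r, a, fun n => hr' _, ha⟩
  · exact ⟨fun n => g * a n, by simpa only [mul_smul] using ha.smul g⟩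

end NonElementary

/-! ### Consequences of relative metric ergodicity -/

section Ergodicity

variable {Γ : Type*} [Group Γ]

theorem IsNonsingularAction.quasiMeasurePreserving {Ω : Type*} [MeasurableSpace Ω] [MulAction Γ Ω]
    {μ : Measure Ω} (h : IsNonsingularAction Γ μ) (g : Γ) :
    Measure.QuasiMeasurePreserving (fun ω : Ω => g • ω) μ μ :=
  ⟨h.measurable_smul g, Measure.AbsolutelyContinuous.mk fun A hA h0 => by
    rw [Measure.map_apply (h.measurable_smul g) hA]
    exact (h.null_smul g A hA).2 h0⟩

/-- Relative metric ergodicity for the bundle `Y × S` with the action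
`g • (y, s) = (g • y, σ g y s)` by isometries between the fibres: a section over `Ω` descends
to `Y`. -/
theorem IsRelativelyMetricallyErgodic.exists_section {Ω Y : Type*} [MeasurableSpace Ω]
    [MulAction Γ Ω] [MeasurableSpace Y] [StandardBorelSpace Y] [MulAction Γ Y] {μ : Measure Ω}
    {ν : Measure Y} {p : Ω → Y} (hp : IsRelativelyMetricallyErgodic Γ μ ν p)
    (hpm : Measurable p) (hpe : ∀ (g : Γ) ω, p (g • ω) = g • p ω)
    (hY : ∀ g : Γ, Measurable fun y : Y => g • y)
    {S : Type} [MeasurableSpace S] [StandardBorelSpace S] {d : S → S → ℝ}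
    (hd : Measurable fun q : S × S => d q.1 q.2) (hd_nonneg : ∀ s t, 0 ≤ d s t)
    (hd_zero : ∀ s t, d s t = 0 ↔ s = t) (hd_symm : ∀ s t, d s t = d t s)
    (hd_triangle : ∀ s t u, d s u ≤ d s t + d t u)
    (hd_sep : ∃ D : Set S, D.Countable ∧ ∀ s, ∀ ε > 0, ∃ t ∈ D, d s t < ε)
    {σ : Γ → Y → S → S} (hσ : ∀ g, Measurable fun q : Y × S => σ g q.1 q.2)
    (hσ_one : ∀ y s, σ 1 y s = s) (hσ_mul : ∀ g k y s, σ (g * k) y s = σ g (k • y) (σ k y s))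
    (hσ_isom : ∀ g y s t, d (σ g y s) (σ g y t) = d s t)
    {F : Ω → S} (hF : Measurable F) (hFe : ∀ g : Γ, ∀ᵐ ω ∂μ, F (g • ω) = σ g (p ω) (F ω)) :
    ∃ β : Y → S, Measurable β ∧ (∀ g : Γ, ∀ᵐ y ∂ν, β (g • y) = σ g y (β y)) ∧ F =ᵐ[μ] β ∘ p := by
  -- replace `Y` by a Borel set of real numbers, so that the bundle is in the lowest universe
  obtain ⟨f, hf⟩ := exists_measurableEmbedding_real Y
  let e : Y ≃ᵐ range f := hf.equivRange
  have : StandardBorelSpace (range f) := hf.measurableSet_range.standardBorel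
  let act : MulAction Γ (range f × S) :=
    { smul := fun g m => (e (g • e.symm m.1), σ g (e.symm m.1) m.2)
      one_smul := fun m => by
        refine Prod.ext ?_ (hσ_one _ _)
        change e ((1 : Γ) • e.symm m.1) = m.1
        rw [one_smul, e.apply_symm_apply]
      mul_smul := fun g k m => by
        refine Prod.ext ?_ ?_
        · change e ((g * k) • e.symm m.1) = e (g • e.symm (e (k • e.symm m.1)))
          rw [e.symm_apply_apply, mul_smul]
        · change σ (g * k) (e.symm m.1) m.2
            = σ g (e.symm (e (k • e.symm m.1))) (σ k (e.symm m.1) m.2)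
          rw [e.symm_apply_apply, hσ_mul] }
  have hsmul : ∀ (g : Γ) (m : range f × S),
      g • m = (e (g • e.symm m.1), σ g (e.symm m.1) m.2) := fun _ _ => rfl
  have hiso : IsFiberwiseIsometric Γ (fun m : range f × S => e.symm m.1)
      (fun m m' => d m.2 m'.2) :=
    { measurable_proj := e.symm.measurable.comp measurable_fst
      measurable_smul := fun g => by
        have h1 : Measurable fun m : range f × S => (e.symm m.1, m.2) :=
          (e.symm.measurable.comp measurable_fst).prodMk measurable_snd
        exact (e.measurable.comp ((hY g).comp (e.symm.measurable.comp measurable_fst))).prodMk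
          ((hσ g).comp h1)
      measurable_metric := hd.comp
        (((measurable_snd.comp measurable_fst).prodMk (measurable_snd.comp measurable_snd)).comp
          measurable_subtype_coe)
      nonneg := fun m m' _ => hd_nonneg _ _
      eq_zero_iff := fun m m' h => by
        rw [hd_zero]
        exact ⟨fun h' => Prod.ext (e.symm.injective h) h', fun h' => by rw [h']⟩
      symm := fun m m' _ => hd_symm _ _
      triangle := fun m m' m'' _ _ => hd_triangle _ _ _
      separable := fun y => by
        obtain ⟨D, hD, hD'⟩ := hd_sep
        refine ⟨{e y} ×ˢ D, (countable_singleton _).prod hD, fun m _ ε hε => ?_⟩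
        obtain ⟨t, ht, h⟩ := hD' m.2 ε hε
        exact ⟨(e y, t), ⟨rfl, ht⟩, e.symm_apply_apply y, h⟩
      equivariant := fun g m => by
        rw [hsmul, e.symm_apply_apply]
      isometric := fun g m m' h => by
        rw [hsmul, hsmul]
        change e.symm m.1 = e.symm m'.1 at h
        rw [h]
        exact hσ_isom _ _ _ _ }
  obtain ⟨b, ⟨hb, hbe⟩, hbq, hbF⟩ := hp (range f × S) _ _ hiso (fun ω => (e (p ω), F ω))
    ⟨(e.measurable.comp hpm).prodMk hF, fun g => by
      filter_upwards [hFe g] with ω hω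
      rw [hsmul, hpe, hω, e.symm_apply_apply]⟩
    (Eventually.of_forall fun ω => e.symm_apply_apply _)
  refine ⟨fun y => (b y).2, measurable_snd.comp hb, fun g => ?_, ?_⟩
  · filter_upwards [hbe g, hbq] with y hy hq
    rw [hy, hsmul, hq]
  · filter_upwards [hbF] with ω hω
    exact congrArg Prod.snd hω

theorem IsRelativelyMetricallyErgodic.comp_swap {B B' : Type*} [MeasurableSpace B]
    [MulAction Γ B] [MeasurableSpace B'] [MulAction Γ B'] {μ : Measure B} {μ' : Measure B'}
    [IsProbabilityMeasure μ] [IsProbabilityMeasure μ'] {Y : Type*} [MeasurableSpace Y]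
    [MulAction Γ Y] {ν : Measure Y} {p : B × B' → Y}
    (h : IsRelativelyMetricallyErgodic Γ (μ.prod μ') ν p) :
    IsRelativelyMetricallyErgodic Γ (μ'.prod μ) ν (p ∘ Prod.swap) := by
  have hs : Measure.QuasiMeasurePreserving Prod.swap (μ'.prod μ) (μ.prod μ') :=
    Measure.measurePreserving_swap.quasiMeasurePreserving
  have hs' : Measure.QuasiMeasurePreserving Prod.swap (μ.prod μ') (μ'.prod μ) :=
    Measure.measurePreserving_swap.quasiMeasurePreserving
  intro M _ _ _ q d hqd F hF hqF
  obtain ⟨f, hf, hfq, hfF⟩ := h M q d hqd (F ∘ Prod.swap)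
    ⟨hF.1.comp measurable_swap, fun g => hs'.ae (hF.2 g)⟩ (hs'.ae hqF)
  exact ⟨f, hf, hfq, hs.ae hfF⟩

variable {B B' : Type*} [MeasurableSpace B] [MulAction Γ B] [MeasurableSpace B'] [MulAction Γ B']
  {μ : Measure B} {μ' : Measure B'} [IsProbabilityMeasure μ] [IsProbabilityMeasure μ']

theorem IsBoundaryPair.quasiMeasurePreserving (hB : IsBoundaryPair Γ μ μ') (g : Γ) :
    Measure.QuasiMeasurePreserving (fun b : B × B' => g • b) (μ.prod μ') (μ.prod μ') :=
  QuasiMeasurePreserving.prodMap (hB.nonsingular_minus.quasiMeasurePreserving g)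
    (hB.nonsingular_plus.quasiMeasurePreserving g)

/-- The two spaces of a boundary pair play symmetric roles. -/
theorem IsBoundaryPair.symm (hB : IsBoundaryPair Γ μ μ') : IsBoundaryPair Γ μ' μ :=
  ⟨hB.nonsingular_plus, hB.nonsingular_minus, hB.amenable_plus, hB.amenable_minus,
    hB.ergodic_plus.comp_swap, hB.ergodic_minus.comp_swap⟩

variable [StandardBorelSpace B']

/-- A `Γ`-map from `B` to a countable set with an action of `Γ` is constant almost everywhere. -/
theorem IsBoundaryPair.eq_const_of_countable (hB : IsBoundaryPair Γ μ μ') {S : Type*} [Countable S]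
    [MulAction Γ S] {F : B → S} (hF : ∀ s, MeasurableSet (F ⁻¹' {s}))
    (hFe : ∀ g : Γ, ∀ᵐ x ∂μ, F (g • x) = g • F x) :
    ∃ s : S, (∀ g : Γ, g • s = s) ∧ ∀ᵐ x ∂μ, F x = s := by
  classical
  let e := equivShrink.{0} S
  let : MeasurableSpace (Shrink.{0} S) := ⊤
  have : DiscreteMeasurableSpace (Shrink.{0} S) := ⟨fun _ => trivial⟩
  have : Countable (Shrink.{0} S) := e.symm.injective.countable
  -- the discrete metric, constant along the fibres of the projection to `B'`
  let d : Shrink.{0} S → Shrink.{0} S → ℝ := fun s t => if s = t then 0 else 1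
  have hd : ∀ s t, 0 ≤ d s t := fun s t => by dsimp only [d]; split_ifs <;> norm_num
  have hfst : Measure.QuasiMeasurePreserving Prod.fst (μ.prod μ') μ :=
    Measure.quasiMeasurePreserving_fst
  have hFm : Measurable fun b : B × B' => e (F b.1) := by
    refine measurable_to_countable' fun s => ?_
    have : (fun b : B × B' => e (F b.1)) ⁻¹' {s} = Prod.fst ⁻¹' (F ⁻¹' {e.symm s}) := by
      ext b
      simp [Equiv.eq_symm_apply]
    rw [this]
    exact measurable_fst (hF _)
  obtain ⟨β, -, -, h⟩ := hB.ergodic_plus.exists_section measurable_snd (fun _ _ => rfl)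
    hB.nonsingular_plus.measurable_smul (d := d) (Measurable.of_discrete) hd
    (fun s t => by simp [d]) (fun s t => by simp [d, eq_comm])
    (fun s t u => by
      have h1 := hd s t
      have h2 := hd t u
      by_cases hst : s = t
      · subst hst; simp [d]
      · have : d s t = 1 := if_neg hst
        have : d s u ≤ 1 := by dsimp only [d]; split_ifs <;> norm_num
        linarith)
    ⟨univ, countable_univ, fun s ε hε => ⟨s, mem_univ _, by simpa [d] using hε⟩⟩
    (σ := fun g _ s => e (g • e.symm s))
    (fun g => (Measurable.of_discrete (f := fun s : Shrink.{0} S => e (g • e.symm s))).comp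
      measurable_snd)
    (fun _ _ => by simp) (fun _ _ _ _ => by simp [mul_smul]) (fun _ _ _ _ => by simp [d])
    hFm (fun g => by
      filter_upwards [hfst.ae (hFe g)] with b hb
      have : F (g • b).1 = g • F b.1 := hb
      rw [this, e.symm_apply_apply])
  have h' : ∀ᵐ y ∂μ', ∀ᵐ x ∂μ, e (F x) = β y :=
    Measure.ae_ae_of_ae_prod (Measure.measurePreserving_swap.quasiMeasurePreserving.ae h)
  obtain ⟨y, hy⟩ := h'.exists
  have hconst : ∀ᵐ x ∂μ, F x = e.symm (β y) := by
    filter_upwards [hy] with x hx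
    rw [← hx, e.symm_apply_apply]
  refine ⟨_, fun g => ?_, hconst⟩
  obtain ⟨x, h1, h2, h3⟩ := ((hFe g).and (hconst.and
    ((hB.nonsingular_minus.quasiMeasurePreserving g).ae hconst))).exists
  exact (congrArg _ h2.symm).trans (h1.symm.trans h3)

variable [StandardBorelSpace B]

/-- The action on the product of a boundary pair is ergodic: an invariant real function on the
product comes from both factors, so it is constant. -/
theorem IsBoundaryPair.ergodic (hB : IsBoundaryPair Γ μ μ') {A : Set (B × B')}
    (hA : MeasurableSet A) (hinv : ∀ g : Γ, ∀ᵐ b ∂(μ.prod μ'), g • b ∈ A ↔ b ∈ A) :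
    (∀ᵐ b ∂(μ.prod μ'), b ∈ A) ∨ ∀ᵐ b ∂(μ.prod μ'), b ∉ A := by
  have hF : Measurable (A.indicator (1 : B × B' → ℝ)) := measurable_one.indicator hA
  have hFe : ∀ g : Γ, ∀ᵐ b ∂(μ.prod μ'),
      A.indicator (1 : B × B' → ℝ) (g • b) = A.indicator 1 b := fun g => by
    filter_upwards [hinv g] with b hb
    by_cases h : b ∈ A
    · simp [h, hb.2 h]
    · simp [h, mt hb.1 h]
  have hsep : ∃ D : Set ℝ, D.Countable ∧ ∀ s, ∀ ε > 0, ∃ t ∈ D, dist s t < ε := by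
    obtain ⟨D, hD, hD'⟩ := TopologicalSpace.exists_countable_dense ℝ
    exact ⟨D, hD, fun s ε hε => hD'.exists_dist_lt s hε⟩
  obtain ⟨β, -, -, h1⟩ := hB.ergodic_minus.exists_section measurable_fst (fun _ _ => rfl)
    hB.nonsingular_minus.measurable_smul (measurable_fst.dist measurable_snd)
    (fun _ _ => dist_nonneg) (fun _ _ => dist_eq_zero) dist_comm dist_triangle hsep
    (σ := fun _ _ s => s) (fun _ => measurable_snd) (fun _ _ => rfl) (fun _ _ _ _ => rfl)
    (fun _ _ _ _ => rfl) hF hFe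
  obtain ⟨β', -, -, h2⟩ := hB.ergodic_plus.exists_section measurable_snd (fun _ _ => rfl)
    hB.nonsingular_plus.measurable_smul (measurable_fst.dist measurable_snd)
    (fun _ _ => dist_nonneg) (fun _ _ => dist_eq_zero) dist_comm dist_triangle hsep
    (σ := fun _ _ s => s) (fun _ => measurable_snd) (fun _ _ => rfl) (fun _ _ _ _ => rfl)
    (fun _ _ _ _ => rfl) hF hFe
  have h3 : ∀ᵐ b ∂(μ.prod μ'), β b.1 = β' b.2 := by
    filter_upwards [h1, h2] with b h1 h2 using h1.symm.trans h2
  obtain ⟨x, hx⟩ := (Measure.ae_ae_of_ae_prod h3).exists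
  have h4 : ∀ᵐ b ∂(μ.prod μ'), β x = β' b.2 := Measure.quasiMeasurePreserving_snd.ae hx
  by_cases hone : β x = 1
  · left
    filter_upwards [h2, h4] with b h2 h4
    by_contra hb
    simp [hb, ← h4, hone] at h2
  · right
    filter_upwards [h2, h4] with b h2 h4 hb
    simp only [indicator_of_mem hb, Pi.one_apply, Function.comp] at h2
    exact hone (h4.trans h2.symm)

theorem IsBoundaryPair.ergodic_left (hB : IsBoundaryPair Γ μ μ') {A : Set B}
    (hA : MeasurableSet A) (hinv : ∀ g : Γ, ∀ᵐ b ∂μ, g • b ∈ A ↔ b ∈ A) :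
    (∀ᵐ b ∂μ, b ∈ A) ∨ ∀ᵐ b ∂μ, b ∉ A := by
  have hfst : Measure.QuasiMeasurePreserving Prod.fst (μ.prod μ') μ :=
    Measure.quasiMeasurePreserving_fst
  have hback : ∀ {p : B → Prop}, (∀ᵐ b ∂(μ.prod μ'), p b.1) → ∀ᵐ x ∂μ, p x := fun h => by
    filter_upwards [Measure.ae_ae_of_ae_prod h] with x hx using hx.exists.choose_spec
  exact (hB.ergodic (measurable_fst hA) fun g => hfst.ae (hinv g)).imp hback hback

end Ergodicity

/-! ### Equivariant fields of averages of distance functions from amenability -/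

section Amenability

variable {Γ : Type*} [Group Γ] {X : Type*} [MetricSpace X] [MulAction Γ X]
  {B : Type*} [MeasurableSpace B] [MulAction Γ B]

/-- A measurable field of averages of distance functions which is equivariant modulo additive
constants. -/
structure IsDistField (o : X) (μ : Measure B) (h : B → Γ → ℝ) : Prop where
  measurable : ∀ a, Measurable fun x => h x a
  average : ∀ x, IsDistAverage o (h x)
  equivariant : ∀ g : Γ, ∀ᵐ x ∂μ, ∀ a b,
    h (g • x) (g * a) - h (g • x) (g * b) = h x a - h x b

theorem dualIsometry_apply {E : Type*} [NormedAddCommGroup E] [NormedSpace ℝ E] (T : E ≃ₗᵢ[ℝ] E)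
    (x : WeakDual ℝ E) (e : E) : dualIsometry T x e = x (T.symm e) := rfl

theorem measurable_weakDual_apply {E : Type*} [NormedAddCommGroup E] [NormedSpace ℝ E] (e : E) :
    Measurable fun x : WeakDual ℝ E => x e :=
  (measurable_pi_apply e).comp (comap_measurable _)

open scoped BoundedContinuousFunction

/-- The functionals on a space `E` of bounded functions which are dominated by the supremum; this is
the weak-* closed convex hull of the evaluations. -/
def supDominated {G E : Type*} [TopologicalSpace G] [NormedAddCommGroup E] [NormedSpace ℝ E]
    (J : E →ₗᵢ[ℝ] (G →ᵇ ℝ)) : Set (WeakDual ℝ E) :=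
  {s | ∀ (e : E) (c : ℝ), (∀ k, J e k ≤ c) → s e ≤ c}

section SupDominated

variable {G E : Type*} [TopologicalSpace G] [NormedAddCommGroup E] [NormedSpace ℝ E]
  {J : E →ₗᵢ[ℝ] (G →ᵇ ℝ)}

theorem supDominated_nonempty [Nonempty G] : (supDominated J).Nonempty := by
  obtain ⟨k⟩ := ‹Nonempty G›
  exact ⟨StrongDual.toWeakDual 
    ((BoundedContinuousFunction.evalCLM ℝ k).comp J.toContinuousLinearMap), fun e c h => h k⟩

theorem convex_supDominated : Convex ℝ (supDominated J) := by
  intro s hs t ht a b ha hb hab e c hc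
  have h1 := mul_le_mul_of_nonneg_left (hs e c hc) ha
  have h2 := mul_le_mul_of_nonneg_left (ht e c hc) hb
  have h3 : (a • s + b • t) e = a * s e + b * t e := rfl
  have h4 : a * c + b * c = c := by rw [← add_mul, hab, one_mul]
  linarith

theorem abs_apply_le_of_mem_supDominated {s : WeakDual ℝ E} (hs : s ∈ supDominated J) (e : E) :
    |s e| ≤ ‖e‖ := by
  have h : ∀ e : E, s e ≤ ‖e‖ := fun e =>
    hs e _ fun k => (le_abs_self _).trans (((J e).norm_coe_le_norm k).trans_eq (J.norm_map e))
  refine abs_le.2 ⟨?_, h e⟩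
  have := h (-e)
  have h' : s (-e) = -s e := (WeakDual.toStrongDual s).map_neg e
  rw [h', norm_neg] at this
  linarith

theorem isCompact_supDominated : IsCompact (supDominated J) := by
  refine (WeakDual.isCompact_closedBall (𝕜 := ℝ) (E := E) 0 1).of_isClosed_subset ?_ ?_
  · simp only [supDominated, ofPred_forall]
    exact isClosed_iInter fun e => isClosed_iInter fun c => isClosed_iInter fun _ =>
      isClosed_le (WeakDual.eval_continuous e) continuous_const
  · intro s hs
    rw [mem_preimage, mem_closedBall_zero_iff]
    refine ContinuousLinearMap.opNorm_le_bound _ zero_le_one fun e => ?_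
    rw [one_mul]
    exact abs_apply_le_of_mem_supDominated hs e

theorem measurableSet_supDominated [TopologicalSpace.SeparableSpace E] :
    MeasurableSet (supDominated J) := by
  obtain ⟨D, hDc, hD⟩ := TopologicalSpace.exists_countable_dense E
  have : supDominated J = ⋂ e ∈ D, ⋂ q : ℚ, ⋂ _ : ∀ k, J e k ≤ (q : ℝ), {s | s e ≤ (q : ℝ)} := by
    ext s
    simp only [mem_iInter, mem_ofPred_eq]
    refine ⟨fun hs e _ q hq => hs e q hq, fun hs e c hc => ?_⟩
    by_contra! hlt
    obtain ⟨ε, hε, hε'⟩ : ∃ ε > 0, c + 2 * ε < s e - ε :=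
      ⟨(s e - c) / 4, by linarith, by linarith⟩
    have hopen : IsOpen {e' : E | s e - ε < s e'} :=
      isOpen_lt continuous_const (WeakDual.toStrongDual s).continuous
    obtain ⟨e', heD, he'⟩ := hD.exists_mem_open (hopen.inter (Metric.isOpen_ball (x := e) (ε := ε)))
      ⟨e, by simp [hε], Metric.mem_ball_self hε⟩
    obtain ⟨q, hq1, hq2⟩ := exists_rat_btwn (show c + ε < c + 2 * ε by linarith)
    have h1 : ∀ k, J e' k ≤ q := fun k => by
      have h2 : |J (e' - e) k| ≤ ‖e' - e‖ :=
        ((J (e' - e)).norm_coe_le_norm k).trans_eq (J.norm_map _)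
      have h3 : ‖e' - e‖ < ε := by rw [← dist_eq_norm]; exact he'.2
      have h4 : J (e' - e) k = J e' k - J e k := by
        rw [map_sub]; rfl
      linarith [hc k, le_abs_self (J (e' - e) k)]
    have h5 := hs e' heD q h1
    have h6 : s e - ε < s e' := he'.1
    linarith
  rw [this]
  exact MeasurableSet.biInter hDc fun e _ => MeasurableSet.iInter fun q => MeasurableSet.iInter
    fun _ => measurableSet_le (measurable_weakDual_apply e) measurable_const

end SupDominated

section DistanceDifferences

/-- The bounded function `k ↦ d(k • o, a • o) - d(k • o, b • o)` on `Γ`, which is replaced by a copy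
in the lowest universe. -/
noncomputable def distDiff [Small.{0} Γ] [TopologicalSpace (Shrink.{0} Γ)]
    [DiscreteTopology (Shrink.{0} Γ)] (o : X) (a b : Γ) : Shrink.{0} Γ →ᵇ ℝ :=
  BoundedContinuousFunction.ofNormedAddCommGroupDiscrete
    (fun k => dist (Shrink.mulEquiv k • o) (a • o) - dist (Shrink.mulEquiv k • o) (b • o))
    (dist (a • o) (b • o)) fun k => by
      rw [Real.norm_eq_abs, dist_comm _ (a • o), dist_comm _ (b • o)]
      exact abs_dist_sub_le _ _ _

variable [Small.{0} Γ] [TopologicalSpace (Shrink.{0} Γ)] [DiscreteTopology (Shrink.{0} Γ)]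

theorem distDiff_apply (o : X) (a b : Γ) (k : Shrink.{0} Γ) : distDiff o a b k =
    dist (Shrink.mulEquiv k • o) (a • o) - dist (Shrink.mulEquiv k • o) (b • o) := rfl

/-- Left translation by `g⁻¹` of bounded functions on `Γ`. -/
noncomputable def translate (g : Γ) : (Shrink.{0} Γ →ᵇ ℝ) →ₗᵢ[ℝ] (Shrink.{0} Γ →ᵇ ℝ) where
  toFun f := f.compContinuous
    ⟨fun k => Shrink.mulEquiv.symm g⁻¹ * k, continuous_of_discreteTopology⟩
  map_add' _ _ := rfl
  map_smul' _ _ := rfl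
  norm_map' f := by
    refine le_antisymm (f.norm_compContinuous_le _) ?_
    refine (BoundedContinuousFunction.norm_le (norm_nonneg _)).2 fun k => ?_
    have := BoundedContinuousFunction.norm_coe_le_norm (f.compContinuous
      ⟨fun k => Shrink.mulEquiv.symm g⁻¹ * k, continuous_of_discreteTopology⟩)
      (Shrink.mulEquiv.symm g * k)
    simpa [← mul_assoc, ← map_mul] using this

theorem translate_apply (g : Γ) (f : Shrink.{0} Γ →ᵇ ℝ) (k : Shrink.{0} Γ) :
    translate g f k = f (Shrink.mulEquiv.symm g⁻¹ * k) := rfl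

theorem translate_mul (g h : Γ) (f : Shrink.{0} Γ →ᵇ ℝ) :
    translate (g * h) f = translate g (translate h f) := by
  ext k
  simp [translate_apply, mul_assoc]

theorem translate_one (f : Shrink.{0} Γ →ᵇ ℝ) : translate (1 : Γ) f = f := by
  ext k
  simp [translate_apply]

theorem translate_distDiff [IsIsometricSMul Γ X] (o : X) (g a b : Γ) :
    translate g (distDiff o a b) = distDiff o (g * a) (g * b) := by
  ext k
  have h : ∀ c : Γ, dist ((g⁻¹ * Shrink.mulEquiv k) • o) (c • o)
      = dist (Shrink.mulEquiv k • o) ((g * c) • o) := fun c => by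
    rw [← dist_smul g, ← mul_smul, ← mul_smul, mul_inv_cancel_left]
  simp only [translate_apply, distDiff_apply, map_mul, MulEquiv.apply_symm_apply, h]

variable (Γ) in
/-- The closed span of the differences of distance functions. -/
noncomputable def distSpace (o : X) : Submodule ℝ (Shrink.{0} Γ →ᵇ ℝ) :=
  (Submodule.span ℝ (range fun p : Γ × Γ => distDiff o p.1 p.2)).topologicalClosure

theorem distDiff_mem (o : X) (a b : Γ) : distDiff o a b ∈ distSpace Γ o :=
  Submodule.le_topologicalClosure _ (Submodule.subset_span ⟨(a, b), rfl⟩)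

theorem translate_mem [IsIsometricSMul Γ X] (o : X) (g : Γ) {f : Shrink.{0} Γ →ᵇ ℝ}
    (hf : f ∈ distSpace Γ o) : translate g f ∈ distSpace Γ o := by
  refine map_mem_closure (translate g).continuous hf fun f hf => ?_
  have : Submodule.span ℝ (range fun p : Γ × Γ => distDiff o p.1 p.2) ≤
      (Submodule.span ℝ (range fun p : Γ × Γ => distDiff o p.1 p.2)).comap
        (translate g).toLinearMap := by
    rw [Submodule.span_le]
    rintro _ ⟨p, rfl⟩
    exact Submodule.subset_span ⟨(g * p.1, g * p.2), (translate_distDiff o g p.1 p.2).symm⟩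
  exact this hf

instance [Countable Γ] (o : X) : TopologicalSpace.SeparableSpace (distSpace Γ o) :=
  (countable_range _).isSeparable.span.closure.separableSpace

instance (o : X) : CompleteSpace (distSpace Γ o) :=
  (Submodule.isClosed_topologicalClosure _).completeSpace_coe

/-- The isometric action of `Γ` on the closed span of the differences of distance functions. -/
noncomputable def translateEquiv [IsIsometricSMul Γ X] (o : X) (g : Γ) :
    distSpace Γ o ≃ₗᵢ[ℝ] distSpace Γ o where
  toFun f := ⟨translate g f.1, translate_mem o g f.2⟩
  invFun f := ⟨translate g⁻¹ f.1, translate_mem o g⁻¹ f.2⟩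
  map_add' f f' := Subtype.ext (map_add (translate g) f.1 f'.1)
  map_smul' c f := Subtype.ext (map_smul (translate g) c f.1)
  left_inv f := Subtype.ext <| by
    change translate g⁻¹ (translate g f.1) = f.1
    rw [← translate_mul, inv_mul_cancel, translate_one]
  right_inv f := Subtype.ext <| by
    change translate g (translate g⁻¹ f.1) = f.1
    rw [← translate_mul, mul_inv_cancel, translate_one]
  norm_map' f := (translate g).norm_map f.1

end DistanceDifferences

/-- The construction of an equivariant field from amenability, for a separable Banach space `E` of
bounded functions on `Γ` which is invariant under translations and contains the differences of
distance functions. -/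
theorem IsAmenableAction.exists_isDistField_of_space [Small.{0} Γ]
    [TopologicalSpace (Shrink.{0} Γ)] [DiscreteTopology (Shrink.{0} Γ)] [IsIsometricSMul Γ X]
    {μ : Measure B} (hμ : IsAmenableAction Γ μ) {o : X} {E : Type} [NormedAddCommGroup E]
    [NormedSpace ℝ E] [CompleteSpace E] [TopologicalSpace.SeparableSpace E]
    {J : E →ₗᵢ[ℝ] (Shrink.{0} Γ →ᵇ ℝ)} {T : Γ → (E ≃ₗᵢ[ℝ] E)}
    (hT : ∀ g e, J (T g e) = translate g (J e)) {F : Γ → Γ → E}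
    (hF : ∀ a b, J (F a b) = distDiff o a b) : ∃ h : B → Γ → ℝ, IsDistField o μ h := by
  let _ : MeasurableSpace E := borel _
  have : BorelSpace E := ⟨rfl⟩
  have hTsymm : ∀ g e, (T g).symm e = T g⁻¹ e := by
    intro g e
    rw [LinearIsometryEquiv.symm_apply_eq]
    refine J.injective ?_
    rw [hT, hT, ← translate_mul, mul_inv_cancel, translate_one]
  have hTmul : ∀ g h e, T (g * h) e = T g (T h e) := fun g h e => J.injective (by
    rw [hT, hT, hT, translate_mul])
  have hTF : ∀ g a b, T g (F a b) = F (g * a) (g * b) := fun g a b => J.injective (by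
    rw [hT, hF, hF, translate_distDiff])
  have hFsub : ∀ a b, F a b = F a 1 - F b 1 := fun a b => J.injective (by
    rw [map_sub, hF, hF, hF]
    refine BoundedContinuousFunction.ext fun k => ?_
    change distDiff o a b k = distDiff o a 1 k - distDiff o b 1 k
    simp only [distDiff_apply]
    ring)
  -- the set of functionals is invariant because translations permute the values of a function
  have hinv : ∀ g : Γ, ∀ s ∈ supDominated J, dualIsometry (T g) s ∈ supDominated J := by
    intro g s hs e c hc
    refine hs ((T g).symm e) c fun k => ?_
    rw [hTsymm, hT, translate_apply]
    exact hc _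
  have hinv' : ∀ (g : Γ) (s : WeakDual ℝ E), dualIsometry (T g) (dualIsometry (T g⁻¹) s) = s := by
    intro g s
    refine DFunLike.ext _ _ fun e => ?_
    rw [dualIsometry_apply, dualIsometry_apply, hTsymm, inv_inv,
      LinearIsometryEquiv.apply_symm_apply]
  obtain ⟨s, hs, hsA, hse⟩ := hμ E (fun g _ => T g) (fun _ => supDominated J)
    ⟨fun g e => measurable_const, fun g h _ e => hTmul g h e⟩
    { nonempty := fun _ => supDominated_nonempty
      convex := fun _ => convex_supDominated
      isCompact := fun _ => isCompact_supDominated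
      subset_ball := fun _ _ => abs_apply_le_of_mem_supDominated
      measurable := measurable_snd measurableSet_supDominated
      invariant := fun g _ => by
        refine Subset.antisymm (fun s hs => ?_) (image_subset_iff.2 (hinv g))
        exact ⟨_, hinv g⁻¹ s hs, hinv' g s⟩ }
  obtain ⟨s₀, hs₀⟩ := supDominated_nonempty (J := J)
  classical
  let s' : B → WeakDual ℝ E := fun x => if s x ∈ supDominated J then s x else s₀
  have hs' : Measurable s' := Measurable.ite (hs measurableSet_supDominated) hs measurable_const
  have hs'A : ∀ x, s' x ∈ supDominated J := fun x => by
    dsimp only [s']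
    split_ifs with h
    exacts [h, hs₀]
  refine ⟨fun x a => s' x (F a 1), fun a => (measurable_weakDual_apply (F a 1)).comp hs',
    fun x n a w c hw hc => ?_, fun g => ?_⟩
  · have h1 : s' x (∑ i, w i • F (a i) 1) ≤ c := hs'A x _ c fun k => by
      have h2 : J (∑ i, w i • F (a i) 1) k = ∑ i, w i * (dist (Shrink.mulEquiv k • o) (a i • o)
          - dist (Shrink.mulEquiv k • o) ((1 : Γ) • o)) := by
        simp only [map_sum, map_smul, hF, BoundedContinuousFunction.coe_sum, Finset.sum_apply]
        rfl
      rw [h2]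
      simp only [mul_sub, Finset.sum_sub_distrib, ← Finset.sum_mul, hw, zero_mul, sub_zero]
      exact hc _
    have h3 : s' x (∑ i, w i • F (a i) 1) = ∑ i, w i * s' x (F (a i) 1) := by
      change WeakDual.toStrongDual (s' x) _ = _
      rw [map_sum]
      simp only [map_smul, smul_eq_mul]
      rfl
    rw [← h3]
    exact h1
  · filter_upwards [hsA, hse g] with x hx hgx a b
    have h1 : s' x = s x := if_pos hx
    have h2 : s' (g • x) = dualIsometry (T g) (s x) := by
      rw [← hgx]
      exact if_pos (by rw [hgx]; exact hinv g _ hx)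
    have h3 : ∀ (t : WeakDual ℝ E) (a b : Γ), t (F a 1) - t (F b 1) = t (F a b) := by
      intro t a b
      rw [hFsub a b]
      exact ((WeakDual.toStrongDual t).map_sub _ _).symm
    rw [h3, h3, h1, h2, dualIsometry_apply, hTsymm, hTF, inv_mul_cancel_left, inv_mul_cancel_left]

/-- An amenable action on `B` carries an equivariant field of averages of distance functions: apply
the definition of amenability to the weak-* closed convex hull of the distance functions, in the
dual of the space spanned by their differences. -/
theorem IsAmenableAction.exists_isDistField [Countable Γ] [IsIsometricSMul Γ X] {μ : Measure B}
    (hμ : IsAmenableAction Γ μ) (o : X) : ∃ h : B → Γ → ℝ, IsDistField o μ h := by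
  let _ : TopologicalSpace (Shrink.{0} Γ) := ⊥
  have : DiscreteTopology (Shrink.{0} Γ) := ⟨rfl⟩
  exact hμ.exists_isDistField_of_space (J := (distSpace Γ o).subtypeₗᵢ) (T := translateEquiv o)
    (E := distSpace Γ o)
    (F := fun a b => ⟨distDiff o a b, distDiff_mem o a b⟩) (fun _ _ => rfl) (fun _ _ => rfl)

end Amenability

/-! ### Limit sets of equivariant fields -/

section Fields

variable {Γ : Type*} [Group Γ] {X : Type*} [MetricSpace X] [MulAction Γ X]
  {B B' : Type*} [MeasurableSpace B] [MulAction Γ B] [MeasurableSpace B'] [MulAction Γ B']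
  {μ : Measure B} {μ' : Measure B'} {o : X} {h : B → Γ → ℝ} {h' : B' → Γ → ℝ}

/-- A measurable field of averages of distance functions which is equivariant, with no additive
constants involved. -/
structure IsExactField (o : X) (μ : Measure B) (h : B → Γ → ℝ) : Prop where
  measurable : ∀ a, Measurable fun x => h x a
  average : ∀ x, IsDistAverage o (h x)
  equivariant : ∀ g : Γ, ∀ᵐ x ∂μ, ∀ a, h (g • x) (g * a) = h x a

theorem IsExactField.isDistField (hh : IsExactField o μ h) : IsDistField o μ h :=
  ⟨hh.measurable, hh.average, fun g => by
    filter_upwards [hh.equivariant g] with x hx a b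
    rw [hx, hx]⟩

variable [IsGromovHyperbolic X]

theorem mem_sublevelLimits_iff {h : Γ → ℝ} {ξ : GromovBoundary X} {v : ℕ → X}
    (hv : TendsToBoundary v ξ) : ξ ∈ sublevelLimits o h ↔ ∃ r : ℕ, ∀ n : ℕ, ∃ a, h a ≤ r ∧
      ∃ N : ℕ, ∀ m : ℕ, N ≤ m → (n : ℝ) ≤ gromovProduct o (a • o) (v m) := by
  constructor
  · rintro ⟨r, a, hr, ha⟩
    obtain ⟨s, hs⟩ := exists_nat_ge r
    refine ⟨s, fun n => ?_⟩
    obtain ⟨N, hN⟩ := eventually_atTop.1 (tendsto_atTop.1 (ha.tendsto hv o) n)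
    exact ⟨a N.1, (hr _).trans hs, N.2, fun m hm => hN (N.1, m) ⟨le_rfl, hm⟩⟩
  · rintro ⟨r, hr⟩
    choose a ha N hN using hr
    refine ⟨r, a, ha, hv.of_tendsto o ?_⟩
    rw [tendsto_atTop]
    intro b
    obtain ⟨M, hM⟩ := eventually_atTop.1
      (tendsto_atTop.1 (hv.tendsto hv o) (b + hypConst X))
    obtain ⟨K, hK⟩ := exists_nat_ge (b + hypConst X)
    filter_upwards [eventually_ge_atTop M.1, eventually_ge_atTop K] with n hn hnK
    have h1 := hN n (max (N n) M.2) (le_max_left _ _)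
    have h2 := hM (n, max (N n) M.2) ⟨hn, le_max_right _ _⟩
    have h3 : (K : ℝ) ≤ n := by exact_mod_cast hnK
    rw [gromovProduct_comm] at h1
    have := gromovProduct_trans h2 (h1.trans' (by linarith))
    linarith

theorem measurableSet_mem_sublevelLimits [Countable Γ] {B : Type*} [MeasurableSpace B]
    {h : B → Γ → ℝ} (hm : ∀ a, Measurable fun x => h x a) (ξ : GromovBoundary X) :
    MeasurableSet {x | ξ ∈ sublevelLimits o (h x)} := by
  obtain ⟨v, hv⟩ := exists_tendsToBoundary ξ
  simp only [mem_sublevelLimits_iff hv]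
  refine measurableSet_setOfPred.2 (Measurable.exists fun r => Measurable.forall fun n =>
    Measurable.exists fun a => ?_)
  exact (measurableSet_setOfPred.1 (measurableSet_le (hm a) measurable_const)).and measurable_const

theorem IsDistAverage.finite_sublevelLimits {h : Γ → ℝ} (hh : IsDistAverage o h) :
    (sublevelLimits o h).Finite := by
  by_contra hinf
  let f := Set.Infinite.natEmbedding _ hinf
  obtain ⟨i, j, hij, hf⟩ := hh.tendsToBoundary_unique₃ (ξ := fun i => f i) fun i => (f i).2
  exact hij (Fin.ext (f.injective (Subtype.ext hf)))

variable [IsIsometricSMul Γ X]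

theorem smul_mem_sublevelLimits_iff {h h' : Γ → ℝ} {g : Γ}
    (heq : ∀ a b, h' (g * a) - h' (g * b) = h a - h b) {ξ : GromovBoundary X} :
    g • ξ ∈ sublevelLimits o h' ↔ ξ ∈ sublevelLimits o h := by
  refine ⟨fun hξ => ?_, sublevelLimits_smul heq⟩
  rw [← inv_smul_smul g ξ]
  refine sublevelLimits_smul (h := h') (fun a b => ?_) hξ
  rw [← heq, mul_inv_cancel_left, mul_inv_cancel_left]

variable [Countable Γ] [IsProbabilityMeasure μ] [IsProbabilityMeasure μ']

open scoped Pointwise in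
/-- The limit sets of the members of an equivariant field do not all meet each other: otherwise
the intersection with some orbit in the boundary would be, by metric ergodicity, a constant
invariant set with one or two elements. -/
theorem IsDistField.exists_disjoint [StandardBorelSpace B'] (hne : IsNonElementary Γ X)
    (hB : IsBoundaryPair Γ μ μ') (hh : IsDistField o μ h) {G : Set B} (hG : ∀ᵐ x ∂μ, x ∈ G) :
    ∃ x₁ ∈ G, ∃ x₂ ∈ G, Disjoint (sublevelLimits o (h x₁)) (sublevelLimits o (h x₂)) := by
  classical
  by_contra! hcon
  obtain ⟨x₀, hx₀⟩ := hG.exists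
  have hfin : ∀ x, (sublevelLimits o (h x)).Finite := fun x => (hh.average x).finite_sublevelLimits
  -- some boundary point `a` belongs to the limit set with positive probability
  obtain ⟨a, ha⟩ : ∃ a, ¬ ∀ᵐ x ∂μ, a ∉ sublevelLimits o (h x) := by
    by_contra! hall
    have h1 : ∀ᵐ x ∂μ, ∀ a ∈ sublevelLimits o (h x₀), a ∉ sublevelLimits o (h x) :=
      (ae_ball_iff (hfin x₀).countable).2 fun a _ => hall a
    obtain ⟨x, h1, h2⟩ := (h1.and hG).exists
    exact hcon x₀ hx₀ x h2 (Set.disjoint_left.2 h1)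
  let O := MulAction.orbit Γ a
  have : Countable O := (countable_range fun g : Γ => g • a).to_subtype
  have hfinO : ∀ x, {b : O | (b : GromovBoundary X) ∈ sublevelLimits o (h x)}.Finite := fun x =>
    (hfin x).preimage Subtype.val_injective.injOn
  let F : B → Finset O := fun x => (hfinO x).toFinset
  have hF : ∀ x b, b ∈ F x ↔ (b : GromovBoundary X) ∈ sublevelLimits o (h x) := fun x b => by
    simp [F]
  obtain ⟨T, hT, hTF⟩ := hB.eq_const_of_countable (F := F) (fun T => by
      have : F ⁻¹' {T} = ⋂ b : O,
          {x | b ∈ T ↔ (b : GromovBoundary X) ∈ sublevelLimits o (h x)} := by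
        ext x
        simp only [mem_preimage, mem_singleton_iff, mem_iInter, Finset.ext_iff, hF]
        exact forall_congr' fun b => iff_comm
      rw [this]
      refine MeasurableSet.iInter fun b => measurableSet_setOfPred.2 ?_
      exact measurable_const.iff (measurableSet_setOfPred.1
        (measurableSet_mem_sublevelLimits hh.measurable _)))
    (fun g => by
      filter_upwards [hh.equivariant g] with x hx
      ext b
      rw [← Finset.inv_smul_mem_iff, hF, hF, ← smul_mem_sublevelLimits_iff hx]
      rw [← MulAction.orbit.coe_smul, smul_inv_smul])
  have hmem : ∃ x, a ∈ sublevelLimits o (h x) ∧ F x = T := by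
    by_contra! hno
    exact ha (hTF.mono fun x hx hax => hno x hax hx)
  obtain ⟨x, hax, hxT⟩ := hmem
  refine hne.not_invariant (T := (fun b : O => (b : GromovBoundary X)) '' T)
    ⟨a, ⟨a, MulAction.mem_orbit_self a⟩, ?_, rfl⟩ (fun ξ hξ => ?_) ?_
  · rw [← hxT]
    exact (hF _ _).2 hax
  · refine (hh.average x).tendsToBoundary_unique₃ fun i => ?_
    obtain ⟨b, hb, hb'⟩ := hξ i
    rw [← hxT] at hb
    rw [← hb']
    exact (hF _ _).1 hb
  · rintro g _ ⟨b, hb, rfl⟩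
    refine ⟨g • b, ?_, rfl⟩
    rw [← hT g]
    exact Finset.smul_mem_smul_finset hb

/-! ### Exactly equivariant fields -/

/-- There are no exactly equivariant fields on both sides of a boundary pair. By ergodicity there
would be a uniform bound for the levels at which the sublevel sets of `h x` and `h' y` meet. For
fixed `x₁`, `x₂` with disjoint limit sets, quasi-convexity then bounds `h' y` at the base point
for almost all `y`, and so on the whole orbit. -/
theorem IsExactField.not_both [StandardBorelSpace B] [StandardBorelSpace B']
    (hne : IsNonElementary Γ X) (hB : IsBoundaryPair Γ μ μ') (hh : IsExactField o μ h)
    (hh' : IsExactField o μ' h') : False := by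
  let A : ℕ → Set (B × B') := fun n => {b | ∃ a, h b.1 a ≤ n ∧ h' b.2 a ≤ n}
  have hA : ∀ n, MeasurableSet (A n) := fun n => measurableSet_setOfPred.2 <|
    Measurable.exists fun a => (measurableSet_setOfPred.1
      (measurableSet_le ((hh.measurable a).comp measurable_fst)
      measurable_const)).and (measurableSet_setOfPred.1
        (measurableSet_le ((hh'.measurable a).comp measurable_snd) measurable_const))
  have hinv : ∀ n, ∀ g : Γ, ∀ᵐ b ∂(μ.prod μ'), g • b ∈ A n ↔ b ∈ A n := fun n g => by
    filter_upwards [Measure.quasiMeasurePreserving_fst.ae (hh.equivariant g),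
      Measure.quasiMeasurePreserving_snd.ae (hh'.equivariant g)] with b h1 h2
    constructor
    · rintro ⟨a, ha, ha'⟩
      refine ⟨g⁻¹ * a, ?_, ?_⟩
      · rw [← h1, mul_inv_cancel_left]; exact ha
      · rw [← h2, mul_inv_cancel_left]; exact ha'
    · rintro ⟨a, ha, ha'⟩
      refine ⟨g * a, ?_, ?_⟩
      · exact (h1 a).trans_le ha
      · exact (h2 a).trans_le ha'
  obtain ⟨n, hn⟩ : ∃ n, ∀ᵐ b ∂(μ.prod μ'), b ∈ A n := by
    by_contra hcon
    have h1 : ∀ᵐ b ∂(μ.prod μ'), ∀ n, b ∉ A n := ae_all_iff.2 fun n =>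
      (hB.ergodic (hA n) (hinv n)).resolve_left (not_exists.1 hcon n)
    obtain ⟨b, hb⟩ := h1.exists
    obtain ⟨n, hn⟩ := exists_nat_ge (max (h b.1 1) (h' b.2 1))
    exact hb n ⟨1, (le_max_left _ _).trans hn, (le_max_right _ _).trans hn⟩
  obtain ⟨x₁, hx₁, x₂, hx₂, hdisj⟩ := hh.isDistField.exists_disjoint hne hB
    (Measure.ae_ae_of_ae_prod hn)
  obtain ⟨K, hK⟩ := (hh.average x₁).exists_le_of_disjoint hdisj n
  have hbound : ∀ᵐ y ∂μ', h' y 1 ≤ n + K + 2 * hypConst X := by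
    filter_upwards [hx₁, hx₂] with y h1 h2
    obtain ⟨a, ha, ha'⟩ := h1
    obtain ⟨b, hb, hb'⟩ := h2
    have h3 := (hh'.average y).le_max 1 a b
    have h4 := hK a b ha hb
    have h5 := max_le ha' hb'
    rw [one_smul] at h3
    linarith
  have hall : ∀ᵐ y ∂μ', ∀ g : Γ, h' y g ≤ n + K + 2 * hypConst X := by
    refine ae_all_iff.2 fun g => ?_
    filter_upwards [(hB.nonsingular_plus.quasiMeasurePreserving g⁻¹).ae hbound,
      hh'.equivariant g⁻¹] with y h1 h2
    have := h2 g
    rw [inv_mul_cancel] at this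
    linarith
  obtain ⟨y, hy⟩ := hall.exists
  exact hne.not_bddAbove (hh'.average y) ⟨_, by rintro _ ⟨g, rfl⟩; exact hy g⟩

end Fields

/-! ### Normalising a field of averages of distance functions -/

section Normalisation

variable {Γ : Type*} [Group Γ] [Countable Γ] {X : Type*} [MetricSpace X] [MulAction Γ X]
  {B B' : Type*} [MeasurableSpace B] [MulAction Γ B] [MeasurableSpace B'] [MulAction Γ B']
  {μ : Measure B} {μ' : Measure B'} [StandardBorelSpace B] {o : X} {h : B → Γ → ℝ} {h' : B' → Γ → ℝ}

/-- A real function on the product which changes by the same additive constants as the field `h` on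
the first factor comes from the first factor, by relative metric ergodicity for the bundle `B × ℝ`.
Subtracting it makes the field exactly equivariant. -/
theorem IsDistField.exists_isExactField_of_shift (hB : IsBoundaryPair Γ μ μ')
    (hh : IsDistField o μ h) {F : B × B' → ℝ} (hF : Measurable F)
    (hFe : ∀ g : Γ, ∀ᵐ b ∂(μ.prod μ'), F (g • b) = F b + (h (g • b.1) g - h b.1 1)) :
    ∃ h' : B → Γ → ℝ, IsExactField o μ h' := by
  classical
  have hsmul := hB.nonsingular_minus.measurable_smul
  -- on the invariant conull set `A`, equivariance modulo constants holds everywhere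
  let A : Set B := {x | ∀ g a b, h (g • x) (g * a) - h (g • x) (g * b) = h x a - h x b}
  have hA : MeasurableSet A := measurableSet_setOfPred.2 <| Measurable.forall fun g =>
    Measurable.forall fun a => Measurable.forall fun b => measurableSet_setOfPred.1 <|
      measurableSet_eq_fun
        (((hh.measurable _).comp (hsmul g)).sub ((hh.measurable _).comp (hsmul g)))
        ((hh.measurable a).sub (hh.measurable b))
  have hAae : ∀ᵐ x ∂μ, x ∈ A := ae_all_iff.2 hh.equivariant
  have hAsmul : ∀ (k : Γ) (x : B), x ∈ A → k • x ∈ A := by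
    intro k x hx g a b
    have h1 := hx (g * k) (k⁻¹ * a) (k⁻¹ * b)
    have h2 := hx k (k⁻¹ * a) (k⁻¹ * b)
    rw [mul_smul, mul_assoc, mul_assoc, mul_inv_cancel_left, mul_inv_cancel_left] at h1
    rw [mul_inv_cancel_left, mul_inv_cancel_left] at h2
    exact h1.trans h2.symm
  have hAsmul' : ∀ (k : Γ) (x : B), k • x ∈ A ↔ x ∈ A := fun k x =>
    ⟨fun hx => by simpa using hAsmul k⁻¹ _ hx, hAsmul k x⟩
  let c : Γ → B → ℝ := fun g x => if x ∈ A then h (g • x) g - h x 1 else 0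
  have hc : ∀ g, Measurable (c g) := fun g => Measurable.ite hA
    (((hh.measurable g).comp (hsmul g)).sub (hh.measurable 1)) measurable_const
  have hcmul : ∀ g k x, c (g * k) x = c g (k • x) + c k x := by
    intro g k x
    by_cases hx : x ∈ A
    · simp only [c, if_pos hx, if_pos (hAsmul k x hx)]
      have := hAsmul k x hx g k 1
      rw [mul_one] at this
      rw [mul_smul]
      linarith
    · simp only [c, if_neg hx, if_neg (mt (hAsmul' k x).1 hx), add_zero]
  obtain ⟨β, hβ, hβe, -⟩ := hB.ergodic_minus.exists_section measurable_fst (fun _ _ => rfl) hsmul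
    (measurable_fst.dist measurable_snd) (fun _ _ => dist_nonneg) (fun _ _ => dist_eq_zero)
    dist_comm dist_triangle (by
      obtain ⟨D, hD, hD'⟩ := TopologicalSpace.exists_countable_dense ℝ
      exact ⟨D, hD, fun s ε hε => hD'.exists_dist_lt s hε⟩)
    (σ := fun g x s => s + c g x) (fun g => measurable_snd.add ((hc g).comp measurable_fst))
    (fun x s => by simp [c]) (fun g k x s => by rw [hcmul]; ring)
    (fun _ _ _ _ => dist_add_right _ _ _) hF (fun g => by
      filter_upwards [hFe g, Measure.quasiMeasurePreserving_fst.ae hAae] with b hb hbA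
      rw [hb]
      simp only [c, if_pos hbA])
  refine ⟨fun x a => h x a - β x, fun a => (hh.measurable a).sub hβ,
    fun x => (hh.average x).sub_const _, fun g => ?_⟩
  filter_upwards [hAae, hβe g] with x hx hb a
  have h1 := hx g a 1
  rw [mul_one] at h1
  simp only [c, if_pos hx] at hb
  linarith

variable [IsProbabilityMeasure μ] [IsProbabilityMeasure μ']

/-- A criterion for a field to become exactly equivariant after subtraction of constants. Given an
equivariant family of sets `P b` of pairs `(a, q) ∈ Γ × ℕ`, the constants are the infima of
`h x a + q` over `(a, q) ∈ P (x, y)`. -/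
theorem IsDistField.exists_isExactField (hB : IsBoundaryPair Γ μ μ') [StandardBorelSpace B']
    (hh : IsDistField o μ h) {P : B × B' → Γ → ℕ → Prop} (hP : ∀ a q, MeasurableSet {b | P b a q})
    (hPe : ∀ g : Γ, ∀ᵐ b ∂(μ.prod μ'), ∀ a q, P (g • b) (g * a) q ↔ P b a q)
    (hne : ∀ᵐ b ∂(μ.prod μ'), ∃ a q, P b a q)
    (hbdd : ¬ ∀ᵐ b ∂(μ.prod μ'), ¬ BddBelow {t : ℝ | ∃ a q, P b a q ∧ h b.1 a + q = t}) :
    ∃ h' : B → Γ → ℝ, IsExactField o μ h' := by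
  classical
  let S : B × B' → Set ℝ := fun b => {t | ∃ a q, P b a q ∧ h b.1 a + q = t}
  have hm : ∀ a, Measurable fun b : B × B' => h b.1 a := fun a =>
    (hh.measurable a).comp measurable_fst
  have hSmul : ∀ g : Γ, ∀ᵐ b ∂(μ.prod μ'),
      S (g • b) = (fun t => t + (h (g • b.1) g - h b.1 1)) '' S b := fun g => by
    filter_upwards [hPe g, Measure.quasiMeasurePreserving_fst.ae (hh.equivariant g)] with b h1 h2
    ext t
    constructor
    · rintro ⟨a, q, hP, rfl⟩
      refine ⟨_, ⟨g⁻¹ * a, q, ?_, rfl⟩, ?_⟩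
      · rwa [← h1, mul_inv_cancel_left]
      · have := h2 (g⁻¹ * a) 1
        rw [mul_inv_cancel_left, mul_one] at this
        change _ = h (g • b.1) a + q
        linarith
    · rintro ⟨_, ⟨a, q, hP, rfl⟩, rfl⟩
      refine ⟨g * a, q, (h1 a q).2 hP, ?_⟩
      have := h2 a 1
      rw [mul_one] at this
      change h (g • b.1) (g * a) + q = _
      linarith
  have hbdd_iff : ∀ b, BddBelow (S b) ↔ ∃ n : ℕ, ∀ a q, P b a q → -(n : ℝ) ≤ h b.1 a + q := by
    intro b
    constructor
    · rintro ⟨r, hr⟩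
      obtain ⟨n, hn⟩ := exists_nat_ge (-r)
      exact ⟨n, fun a q hP => by linarith [hr ⟨a, q, hP, rfl⟩]⟩
    · rintro ⟨n, hn⟩
      exact ⟨-n, by rintro _ ⟨a, q, hP, rfl⟩; exact hn a q hP⟩
  have hbdd_meas : MeasurableSet {b | BddBelow (S b)} := by
    simp only [hbdd_iff]
    exact measurableSet_setOfPred.2 <| Measurable.exists fun n => Measurable.forall fun a =>
      Measurable.forall fun q => (measurableSet_setOfPred.1 (hP a q)).imp
        (measurableSet_setOfPred.1 (measurableSet_le measurable_const
          ((hm a).add measurable_const)))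
  have hbdd' : ∀ᵐ b ∂(μ.prod μ'), BddBelow (S b) := by
    refine (hB.ergodic hbdd_meas fun g => ?_).resolve_right hbdd
    filter_upwards [hSmul g] with b hb
    rw [hb]
    exact (OrderIso.addRight (h (g • b.1) g - h b.1 1)).bddBelow_image
  have hlt : ∀ (b) (r : ℝ), sInf (S b) < r ↔
      ((∃ a q, P b a q) ∧ BddBelow (S b) ∧ ∃ a q, P b a q ∧ h b.1 a + q < r) ∨
      (¬ ((∃ a q, P b a q) ∧ BddBelow (S b)) ∧ 0 < r) := by
    intro b r
    by_cases h1 : ∃ a q, P b a q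
    · have h1' : (S b).Nonempty := by
        obtain ⟨a, q, hP⟩ := h1
        exact ⟨_, a, q, hP, rfl⟩
      by_cases h2 : BddBelow (S b)
      · rw [csInf_lt_iff h2 h1']
        constructor
        · rintro ⟨_, ⟨a, q, hP, rfl⟩, hr⟩
          exact Or.inl ⟨h1, h2, a, q, hP, hr⟩
        · rintro (⟨-, -, a, q, hP, hr⟩ | ⟨h3, -⟩)
          · exact ⟨_, ⟨a, q, hP, rfl⟩, hr⟩
          · exact absurd ⟨h1, h2⟩ h3
      · rw [Real.sInf_of_not_bddBelow h2]
        simp [h2]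
    · have h1' : S b = ∅ := by
        refine eq_empty_of_forall_notMem ?_
        rintro _ ⟨a, q, hP, -⟩
        exact h1 ⟨a, q, hP⟩
      rw [h1', Real.sInf_empty]
      simp only [h1, false_and, not_false_eq_true, true_and, false_or]
  refine hh.exists_isExactField_of_shift hB (F := fun b => sInf (S b)) ?_ fun g => ?_
  · refine measurable_of_Iio fun r => ?_
    have h1 : Measurable fun b => ∃ a q, P b a q := Measurable.exists fun a =>
      Measurable.exists fun q => measurableSet_setOfPred.1 (hP a q)
    have h2 : Measurable fun b => BddBelow (S b) := measurableSet_setOfPred.1 hbdd_meas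
    have h3 : Measurable fun b => ∃ a q, P b a q ∧ h b.1 a + q < r := Measurable.exists fun a =>
      Measurable.exists fun q => (measurableSet_setOfPred.1 (hP a q)).and
        (measurableSet_setOfPred.1 (measurableSet_lt ((hm a).add measurable_const)
          measurable_const))
    change MeasurableSet {b | sInf (S b) < r}
    simp only [hlt]
    exact measurableSet_setOfPred.2 ((h1.and (h2.and h3)).or ((h1.and h2).not.and
      measurable_const))
  · filter_upwards [hSmul g, hne, hbdd'] with b h1 ⟨a, q, hP⟩ h3
    have h2 : (S b).Nonempty := ⟨_, a, q, hP, rfl⟩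
    rw [h1]
    exact ((OrderIso.addRight (h (g • b.1) g - h b.1 1)).map_csInf' h2 h3).symm

end Normalisation

/-! ### Boundary maps from poles -/

section Bounded

variable {Γ : Type*} [Group Γ] [Countable Γ] {X : Type*} [MetricSpace X] [MulAction Γ X]
  {B B' : Type*} [MeasurableSpace B] [MulAction Γ B] [MeasurableSpace B'] [MulAction Γ B']
  {μ : Measure B} {μ' : Measure B'} [IsProbabilityMeasure μ] [IsProbabilityMeasure μ']
  [StandardBorelSpace B] [StandardBorelSpace B'] {o : X} {h : B → Γ → ℝ}

theorem IsDistField.bddBelow_or (hB : IsBoundaryPair Γ μ μ') (hh : IsDistField o μ h) :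
    (∀ᵐ x ∂μ, BddBelow (range (h x))) ∨ ∀ᵐ x ∂μ, ¬ BddBelow (range (h x)) := by
  have hiff : ∀ x, BddBelow (range (h x)) ↔ ∃ n : ℕ, ∀ a, -(n : ℝ) ≤ h x a := by
    intro x
    constructor
    · rintro ⟨r, hr⟩
      obtain ⟨n, hn⟩ := exists_nat_ge (-r)
      exact ⟨n, fun a => by linarith [hr ⟨a, rfl⟩]⟩
    · rintro ⟨n, hn⟩
      exact ⟨-n, by rintro _ ⟨a, rfl⟩; exact hn a⟩
  refine hB.ergodic_left (A := {x | BddBelow (range (h x))}) ?_ fun g => ?_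
  · simp only [hiff]
    exact measurableSet_setOfPred.2 <| Measurable.exists fun n => Measurable.forall fun a =>
      measurableSet_setOfPred.1 (measurableSet_le measurable_const (hh.measurable a))
  · filter_upwards [hh.equivariant g] with x hx
    have : range (h (g • x)) = (fun t => t + (h (g • x) (g * 1) - h x 1)) '' range (h x) := by
      ext t
      constructor
      · rintro ⟨a, rfl⟩
        refine ⟨_, ⟨g⁻¹ * a, rfl⟩, ?_⟩
        have := hx (g⁻¹ * a) 1
        rw [mul_inv_cancel_left] at this
        linarith
      · rintro ⟨_, ⟨a, rfl⟩, rfl⟩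
        refine ⟨g * a, ?_⟩
        have := hx a 1
        linarith
    change BddBelow (range (h (g • x))) ↔ BddBelow (range (h x))
    rw [this]
    exact (OrderIso.addRight (h (g • x) (g * 1) - h x 1)).bddBelow_image

/-- A field which is bounded below can be made exactly equivariant. -/
theorem IsDistField.exists_isExactField_of_bddBelow (hB : IsBoundaryPair Γ μ μ')
    (hh : IsDistField o μ h) (hb : ∀ᵐ x ∂μ, BddBelow (range (h x))) :
    ∃ h' : B → Γ → ℝ, IsExactField o μ h' := by
  refine hh.exists_isExactField hB (P := fun _ _ _ => True) (fun _ _ => MeasurableSet.univ)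
    (fun _ => by simp) (by simp) fun hcon => ?_
  obtain ⟨b, h1, h2⟩ := (hcon.and (Measure.quasiMeasurePreserving_fst.ae hb)).exists
  obtain ⟨r, hr⟩ := h2
  refine h1 ⟨r, ?_⟩
  rintro _ ⟨a, q, -, rfl⟩
  have : (0 : ℝ) ≤ q := q.cast_nonneg
  linarith [hr ⟨a, rfl⟩]

end Bounded

section Poles

variable {Γ : Type*} [Group Γ] {X : Type*} [MetricSpace X] [MulAction Γ X] [IsGromovHyperbolic X]

/-- The pole of an unbounded average of distance functions depends measurably on it. -/
theorem measurable_pole [Countable Γ] [Nonempty X] [TopologicalSpace.SeparableSpace X]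
    {B : Type*} [MeasurableSpace B] {o : X} {h : B → Γ → ℝ}
    (hm : ∀ a, Measurable fun x => h x a) (ha : ∀ x, IsDistAverage o (h x))
    (hb : ∀ x, ¬ BddBelow (range (h x))) {φ : B → GromovBoundary X}
    (hφ : ∀ x, IsPole o (h x) (φ x)) : Measurable φ := by
  refine measurable_of_isOpen fun V hV => ?_
  -- `φ x ∈ V` if and only if a sublevel set of `h x` consists of orbit points which are close to
  -- a point `w • o` with a shadow inside `V`
  have : φ ⁻¹' V = {x | ∃ (w : Γ) (q : ℕ), shadow o (w • o) q ⊆ V ∧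
      ∃ k : ℕ, ∀ a, h x a ≤ -(k : ℝ) → (q : ℝ) ≤ gromovProduct o (w • o) (a • o)} := by
    ext x
    obtain ⟨u, hu⟩ := exists_tendsto_atBot (hb x)
    have hev : ∀ k : ℕ, ∀ᶠ n in atTop, h x (u n) ≤ -(k : ℝ) := fun k => tendsto_atBot.1 hu _
    constructor
    · intro hx
      obtain ⟨q, hq⟩ := exists_shadow_subset o (hV.mem_nhds hx) (hφ x u hu)
      obtain ⟨k, hk⟩ := exists_nat_ge (q + 2 * hypConst X - h x 1)
      have key : ∀ a b, h x a ≤ -(k : ℝ) → h x b ≤ -(k : ℝ) →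
          (q : ℝ) ≤ gromovProduct o (a • o) (b • o) := fun a b h1 h2 => by
        have h3 := (ha x).le_max 1 a b
        have h4 := max_le h1 h2
        rw [one_smul] at h3
        linarith
      obtain ⟨n, hn⟩ := (hev k).exists
      exact ⟨u n, q, hq _ ((hev k).mono fun m hm => key _ _ hn hm), k, fun a => key _ a hn⟩
    · rintro ⟨w, q, hV, k, hk⟩
      exact hV ⟨_, hφ x u hu, (hev k).mono fun n hn => hk _ hn⟩
  rw [this]
  exact measurableSet_setOfPred.2 <| Measurable.exists fun w => Measurable.exists fun q =>
    measurable_const.and <| Measurable.exists fun k => Measurable.forall fun a =>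
      (measurableSet_setOfPred.1 (measurableSet_le (hm a) measurable_const)).imp measurable_const

variable [IsIsometricSMul Γ X] [Countable Γ]
  {B B' : Type*} [MeasurableSpace B] [MulAction Γ B] [MeasurableSpace B'] [MulAction Γ B']
  {μ : Measure B} {μ' : Measure B'}
  {o : X} {h : B → Γ → ℝ} {h' : B' → Γ → ℝ}

theorem IsDistField.isGammaMap_pole [Nonempty X] [TopologicalSpace.SeparableSpace X]
    (hh : IsDistField o μ h) (hb : ∀ x, ¬ BddBelow (range (h x))) {φ : B → GromovBoundary X}
    (hφ : ∀ x, IsPole o (h x) (φ x)) : IsGammaMap Γ μ φ := by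
  refine ⟨measurable_pole hh.measurable hh.average hb hφ, fun g => ?_⟩
  filter_upwards [hh.equivariant g] with x hx
  exact (hφ (g • x)).unique (hb _) ((hφ x).smul hx)

variable [IsProbabilityMeasure μ] [IsProbabilityMeasure μ'] [StandardBorelSpace B]
  [StandardBorelSpace B']

/-- If one side of a boundary pair carries an exactly equivariant field, then a field on the other
side is not unbounded below. Either its values on a sublevel set of the exactly equivariant
field are bounded below and their infimum makes it exactly equivariant too, or its poles are in
the limit sets of the exactly equivariant field, which then all meet each other. -/
theorem IsDistField.not_unbounded (hne : IsNonElementary Γ X) (hB : IsBoundaryPair Γ μ μ')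
    (hh : IsDistField o μ h) (hb : ∀ᵐ x ∂μ, ¬ BddBelow (range (h x)))
    (hh' : IsExactField o μ' h') : False := by
  -- a level at which almost all sublevel sets of `h'` are non-empty
  obtain ⟨n, hn⟩ : ∃ n : ℕ, ∀ᵐ y ∂μ', ∃ a, h' y a ≤ n := by
    by_contra hcon
    have h1 : ∀ᵐ y ∂μ', ∀ n : ℕ, ¬ ∃ a, h' y a ≤ n := ae_all_iff.2 fun n => by
      refine (hB.symm.ergodic_left (A := {y | ∃ a, h' y a ≤ n}) (measurableSet_setOfPred.2 <|
        Measurable.exists fun a => measurableSet_setOfPred.1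
          (measurableSet_le (hh'.measurable a) measurable_const)) fun g => ?_).resolve_left
            (not_exists.1 hcon n)
      filter_upwards [hh'.equivariant g] with y hy
      constructor
      · rintro ⟨a, ha⟩
        exact ⟨g⁻¹ * a, by rwa [← hy, mul_inv_cancel_left]⟩
      · rintro ⟨a, ha⟩
        exact ⟨g * a, (hy a).trans_le ha⟩
    obtain ⟨y, hy⟩ := h1.exists
    obtain ⟨n, hn⟩ := exists_nat_ge (h' y 1)
    exact hy n ⟨1, hn⟩
  by_cases hcon : ∀ᵐ b ∂(μ.prod μ'),
      ¬ BddBelow {t : ℝ | ∃ a, ∃ q : ℕ, h' b.2 a ≤ n ∧ h b.1 a + q = t}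
  · have h1 : ∀ᵐ b ∂(μ.prod μ'), ∀ ξ, IsPole o (h b.1) ξ → ξ ∈ sublevelLimits o (h' b.2) := by
      filter_upwards [hcon] with b hb ξ hξ
      have h2 : ∀ k : ℕ, ∃ a, h' b.2 a ≤ n ∧ h b.1 a ≤ -(k : ℝ) := by
        intro k
        by_contra! h3
        refine hb ⟨-k, ?_⟩
        rintro _ ⟨a, q, ha, rfl⟩
        have : (0 : ℝ) ≤ q := q.cast_nonneg
        linarith [h3 a ha]
      choose a ha ha' using h2
      exact ⟨n, a, ha, hξ a (tendsto_atBot_mono ha'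
        (tendsto_neg_atTop_atBot.comp tendsto_natCast_atTop_atTop))⟩
    have h2 : ∀ᵐ y ∂μ', ∀ᵐ x ∂μ, ∀ ξ, IsPole o (h x) ξ → ξ ∈ sublevelLimits o (h' y) :=
      Measure.ae_ae_of_ae_prod (Measure.measurePreserving_swap.quasiMeasurePreserving.ae h1)
    obtain ⟨y₁, hy₁, y₂, hy₂, hdisj⟩ := hh'.isDistField.exists_disjoint hne hB.symm h2
    have h3 : ∀ᵐ x ∂μ, ∀ ξ, IsPole o (h x) ξ → ξ ∈ sublevelLimits o (h' y₁) := hy₁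
    have h4 : ∀ᵐ x ∂μ, ∀ ξ, IsPole o (h x) ξ → ξ ∈ sublevelLimits o (h' y₂) := hy₂
    obtain ⟨x, h3, h4, h5⟩ := (hb.and (h3.and h4)).exists
    obtain ⟨ξ, hξ⟩ := (hh.average x).exists_isPole h3
    exact Set.disjoint_left.1 hdisj (h4 ξ hξ) (h5 ξ hξ)
  · obtain ⟨h'', hh''⟩ := hh.exists_isExactField hB (P := fun b a _ => h' b.2 a ≤ n)
      (fun a _ => measurableSet_le ((hh'.measurable a).comp measurable_snd) measurable_const)
      (fun g => by
        filter_upwards [Measure.quasiMeasurePreserving_snd.ae (hh'.equivariant g)] with b hb a q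
        have : h' (g • b).2 (g * a) = h' b.2 a := hb a
        rw [this])
      (by
        filter_upwards [Measure.quasiMeasurePreserving_snd.ae hn] with b ⟨a, ha⟩
        exact ⟨a, 0, ha⟩) hcon
    exact hh''.not_both hne hB hh'

/-- Fields of averages of distance functions on a boundary pair are unbounded below. -/
theorem IsDistField.ae_not_bddBelow (hne : IsNonElementary Γ X) (hB : IsBoundaryPair Γ μ μ')
    (hh : IsDistField o μ h) : ∀ᵐ x ∂μ, ¬ BddBelow (range (h x)) := by
  refine (hh.bddBelow_or hB).resolve_left fun hb => ?_
  obtain ⟨k, hk⟩ := hh.exists_isExactField_of_bddBelow hB hb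
  obtain ⟨h', hh'⟩ := hB.amenable_plus.exists_isDistField o
  rcases hh'.bddBelow_or hB.symm with hb' | hb'
  · obtain ⟨k', hk'⟩ := hh'.exists_isExactField_of_bddBelow hB.symm hb'
    exact hk.not_both hne hB hk'
  · exact hh'.not_unbounded hne hB.symm hb' hk

/-- A field which is almost everywhere unbounded below is modified on a null set, so that it is
unbounded below everywhere. -/
theorem IsBoundaryPair.exists_isDistField (hne : IsNonElementary Γ X) (hB : IsBoundaryPair Γ μ μ')
    (o : X) : ∃ h : B → Γ → ℝ, IsDistField o μ h ∧ ∀ x, ¬ BddBelow (range (h x)) := by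
  classical
  obtain ⟨h, hh⟩ := hB.amenable_minus.exists_isDistField o
  have hb := hh.ae_not_bddBelow hne hB
  obtain ⟨x₀, hx₀⟩ := hb.exists
  obtain ⟨N, hN, hNm, hN0⟩ := exists_measurable_superset_of_null hb
  have hNae : ∀ᵐ x ∂μ, x ∉ N := measure_eq_zero_iff_ae_notMem.1 hN0
  let h' : B → Γ → ℝ := fun x => if x ∈ N then h x₀ else h x
  have hh' : ∀ x, h' x = h x₀ ∧ x ∈ N ∨ h' x = h x ∧ x ∉ N := fun x => by
    by_cases hx : x ∈ N
    · exact Or.inl ⟨if_pos hx, hx⟩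
    · exact Or.inr ⟨if_neg hx, hx⟩
  refine ⟨h', ⟨fun a => ?_, fun x => ?_, fun g => ?_⟩, fun x => ?_⟩
  · have : (fun x => h' x a) = fun x => if x ∈ N then h x₀ a else h x a := by
      ext x
      simp only [h', apply_ite (fun f : Γ → ℝ => f a)]
    rw [this]
    exact Measurable.ite hNm measurable_const (hh.measurable a)
  · rcases hh' x with ⟨h1, -⟩ | ⟨h1, -⟩ <;> rw [h1] <;> exact hh.average _
  · filter_upwards [hh.equivariant g, hNae,
      (hB.nonsingular_minus.quasiMeasurePreserving g).ae hNae] with x h1 h2 h3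
    have h4 : h' x = h x := if_neg h2
    have h5 : h' (g • x) = h (g • x) := if_neg h3
    rw [h4, h5]
    exact h1
  · rcases hh' x with ⟨h1, -⟩ | ⟨h1, h2⟩ <;> rw [h1]
    · exact hx₀
    · exact fun hx => h2 (hN fun hx' => hx' hx)

end Poles

/-! ### Pairs of boundary points seen from a point of the space -/

section NearPairs

variable {X : Type*} [MetricSpace X] [IsGromovHyperbolic X]

/-- The pairs of boundary points whose Gromov product at `z` is at least `q`. The interior is taken
to have a measurable set. The product is defined as a supremum over all representing sequences, so
its superlevel sets need not be open. -/
def nearPairs (z : X) (q : ℕ) : Set (GromovBoundary X × GromovBoundary X) :=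
  interior {p | ((q : ℝ) : EReal) ≤ boundaryProduct z p.1 p.2}

theorem nearPairs_anti (z : X) {q q' : ℕ} (h : q ≤ q') : nearPairs z q' ⊆ nearPairs z q :=
  interior_mono fun _ hp => (EReal.coe_le_coe_iff.2 (by exact_mod_cast h)).trans hp

theorem smul_mem_nearPairs_iff {Γ : Type*} [Group Γ] [MulAction Γ X] [IsIsometricSMul Γ X] (g : Γ)
    (z : X) (q : ℕ) (p : GromovBoundary X × GromovBoundary X) :
    g • p ∈ nearPairs (g • z) q ↔ p ∈ nearPairs z q := by
  have h := (Homeomorph.smul g : (GromovBoundary X × GromovBoundary X) ≃ₜ _).preimage_interior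
    {p | ((q : ℝ) : EReal) ≤ boundaryProduct (g • z) p.1 p.2}
  have h' : (Homeomorph.smul g : (GromovBoundary X × GromovBoundary X) ≃ₜ _) ⁻¹'
      {p | ((q : ℝ) : EReal) ≤ boundaryProduct (g • z) p.1 p.2} =
      {p | ((q : ℝ) : EReal) ≤ boundaryProduct z p.1 p.2} := by
    ext p
    have h1 := boundaryProduct_le_smul g z p.1 p.2
    have h2 := boundaryProduct_le_smul g⁻¹ (g • z) (g • p.1) (g • p.2)
    rw [inv_smul_smul, inv_smul_smul, inv_smul_smul] at h2
    exact ⟨fun hp => le_trans hp h2, fun hp => le_trans hp h1⟩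
  rw [h'] at h
  exact iff_of_eq (congrArg (p ∈ ·) h)

theorem le_boundaryProduct_of_mem_nearPairs {z : X} {q : ℕ}
    {p : GromovBoundary X × GromovBoundary X} (hp : p ∈ nearPairs z q) :
    ((q : ℝ) : EReal) ≤ boundaryProduct z p.1 p.2 := by
  have := interior_subset hp
  exact this

theorem exists_notMem_nearPairs (z : X) {η ζ : GromovBoundary X} (hne : η ≠ ζ) :
    ∃ q, (η, ζ) ∉ nearPairs z q := by
  obtain ⟨v, hv⟩ := exists_tendsToBoundary η
  obtain ⟨w, hw⟩ := exists_tendsToBoundary ζ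
  obtain ⟨K, hK⟩ := hv.eventually_le_of_ne hw hne z
  obtain ⟨q, hq⟩ := exists_nat_gt (K + 1 + 2 * hypConst X)
  refine ⟨q, fun hmem => ?_⟩
  have h1 := le_boundaryProduct_of_mem_nearPairs hmem
  obtain ⟨p, h2, h3⟩ := (hK.and (eventually_le_of_le_boundaryProduct hv hw h1)).exists
  linarith

/-- If `z n → ξ`, then seen from `z n` two points different from `ξ` are close to each other. -/
theorem eventually_mem_nearPairs (o : X) {z : ℕ → X} {ξ η ζ : GromovBoundary X}
    (hz : TendsToBoundary z ξ) (hη : ξ ≠ η) (hζ : ξ ≠ ζ) :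
    ∃ C : ℝ, ∀ᶠ n in atTop, ∀ q : ℕ, (q : ℝ) ≤ dist o (z n) - C →
      (η, ζ) ∈ nearPairs (z n) q := by
  -- points `η'` near `η` have Gromov products with `z n` bounded uniformly in `n` and `η'`
  have key : ∀ η : GromovBoundary X, ξ ≠ η → ∃ (K R : ℝ) (N : ℕ), ∀ n, N ≤ n →
      ∀ η' ∈ boundaryNhd o η R, ∀ v' : ℕ → X, TendsToBoundary v' η' →
        ∀ᶠ m in atTop, gromovProduct o (z n) (v' m) ≤ K := by
    intro η hη
    obtain ⟨v, hv⟩ := exists_tendsToBoundary η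
    obtain ⟨K, hK⟩ := hz.eventually_le_of_ne hv hη o
    obtain ⟨M, hM⟩ := eventually_atTop.1 hK
    refine ⟨K + hypConst X + 1, K + 3 * hypConst X + 2, M.1, fun n hn η' hη' v' hv' => ?_⟩
    filter_upwards [eventually_diag_of_le_boundaryProduct hv hv' hη', eventually_ge_atTop M.2]
      with m h1 h2
    have h3 : gromovProduct o (z n) (v m) ≤ K := hM (n, m) ⟨hn, h2⟩
    by_contra! h4
    rw [gromovProduct_comm o (v m)] at h1
    have h5 : K + hypConst X + 1 ≤ gromovProduct o (v' m) (v m) := by linarith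
    have := gromovProduct_trans h4.le h5
    linarith
  obtain ⟨K₁, R₁, N₁, h₁⟩ := key η hη
  obtain ⟨K₂, R₂, N₂, h₂⟩ := key ζ hζ
  refine ⟨K₁ + K₂, ?_⟩
  filter_upwards [eventually_ge_atTop N₁, eventually_ge_atTop N₂] with n hn₁ hn₂ q hq
  refine mem_interior_iff_mem_nhds.2 (mem_of_superset (prod_mem_nhds
    (boundaryNhd_mem_nhds o η R₁) (boundaryNhd_mem_nhds o ζ R₂)) ?_)
  rintro ⟨η', ζ'⟩ ⟨hη', hζ'⟩
  obtain ⟨v, hv⟩ := exists_tendsToBoundary η'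
  obtain ⟨w, hw⟩ := exists_tendsToBoundary ζ'
  refine le_boundaryProduct hv hw ?_
  filter_upwards [h₁ n hn₁ η' hη' v hv, h₂ n hn₂ ζ' hζ' w hw] with m h3 h4
  rw [gromovProduct_change_base o]
  linarith [gromovProduct_nonneg o (v m) (w m)]

end NearPairs

/-! ### Pole fields and measures on the boundary -/

section ProbabilityMeasures

/-- The mass of the sections of a measurable set depends measurably on the point. -/
theorem measurable_measure_prodMk {Ω V : Type*} [MeasurableSpace Ω] [MeasurableSpace V]
    {ψ : Ω → ProbabilityMeasure V} (hψ : Measurable ψ) {t : Set (Ω × V)} (ht : MeasurableSet t) :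
    Measurable fun b => (ψ b : Measure V) (Prod.mk b ⁻¹' t) := by
  let κ : ProbabilityTheory.Kernel Ω V :=
    ⟨fun b => (ψ b : Measure V), measurable_subtype_coe.comp hψ⟩
  have : ProbabilityTheory.IsMarkovKernel κ := ⟨fun b => (ψ b).2⟩
  exact ProbabilityTheory.Kernel.measurable_kernel_prodMk_left (κ := κ) ht

theorem measure_smul_prob {Γ V : Type*} [Group Γ] [MulAction Γ V] [MeasurableSpace V]
    [MeasurableConstSMul Γ V] (g : Γ) (m : ProbabilityMeasure V) {s : Set V}
    (hs : MeasurableSet s) :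
    ((g • m : ProbabilityMeasure V) : Measure V) s = (m : Measure V) ((fun v => g • v) ⁻¹' s) :=
  Measure.map_apply (measurable_const_smul g) hs

theorem smul_diracProba {Γ V : Type*} [Group Γ] [MulAction Γ V] [MeasurableSpace V]
    [MeasurableConstSMul Γ V] (g : Γ) (v : V) : g • diracProba v = diracProba (g • v) :=
  Subtype.ext (Measure.map_dirac' (measurable_const_smul g) v)

theorem measurable_diracProba {V : Type*} [MeasurableSpace V] :
    Measurable fun v : V => diracProba v :=
  Measure.measurable_dirac.subtype_mk

theorem eq_diracProba {V : Type*} [MeasurableSpace V] {m : ProbabilityMeasure V} {v : V}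
    (h : (m : Measure V) {v}ᶜ = 0) : m = diracProba v := by
  refine Subtype.ext (Measure.ext fun s hs => ?_)
  change (m : Measure V) s = Measure.dirac v s
  rw [Measure.dirac_apply' v hs]
  by_cases hv : v ∈ s
  · rw [indicator_of_mem hv, Pi.one_apply, ← prob_compl_eq_zero_iff hs]
    exact measure_mono_null (compl_subset_compl.2 (singleton_subset_iff.2 hv)) h
  · rw [indicator_of_notMem hv]
    exact measure_mono_null (subset_compl_singleton_iff.2 hv) h

end ProbabilityMeasures

section Lift

variable {Γ : Type*} [Group Γ] {X : Type*} [MetricSpace X] [IsGromovHyperbolic X] [MulAction Γ X]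

/-- A field `h` of averages of distance functions which are unbounded below, with poles `φ`. -/
structure IsPoleField {B : Type*} [MeasurableSpace B] [MulAction Γ B] (o : X) (μ : Measure B)
    (h : B → Γ → ℝ) (φ : B → GromovBoundary X) : Prop where
  isDistField : IsDistField o μ h
  not_bddBelow : ∀ x, ¬ BddBelow (range (h x))
  isPole : ∀ x, IsPole o (h x) (φ x)

/-- The points different from `ξ` and `η`. -/
def awayFrom (ξ η : GromovBoundary X) : Set (GromovBoundary X) := {ζ | ζ ≠ ξ ∧ ζ ≠ η}

theorem awayFrom_comm (ξ η : GromovBoundary X) : awayFrom ξ η = awayFrom η ξ :=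
  Set.ext fun _ => and_comm

variable [IsIsometricSMul Γ X]
  {B B' : Type*} [MeasurableSpace B] [MulAction Γ B] [MeasurableSpace B'] [MulAction Γ B']
  {μ : Measure B} {μ' : Measure B'}
  {o : X} {h : B → Γ → ℝ} {h' : B' → Γ → ℝ}
  {φ : B → GromovBoundary X} {φ' : B' → GromovBoundary X}
  {ψ : B × B' → ProbabilityMeasure (GromovBoundary X)}

theorem IsBoundaryPair.exists_isPoleField [Countable Γ] [IsProbabilityMeasure μ]
    [IsProbabilityMeasure μ'] [StandardBorelSpace B] [StandardBorelSpace B']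
    (hne : IsNonElementary Γ X) (hB : IsBoundaryPair Γ μ μ') (o : X) :
    ∃ (h : B → Γ → ℝ) (φ : B → GromovBoundary X), IsPoleField o μ h φ := by
  obtain ⟨h, hh, hb⟩ := hB.exists_isDistField hne o
  choose φ hφ using fun x => (hh.average x).exists_isPole (hb x)
  exact ⟨h, φ, hh, hb, hφ⟩

variable [Nonempty X] [TopologicalSpace.SeparableSpace X]

theorem IsPoleField.isGammaMap [Countable Γ] (hφ : IsPoleField o μ h φ) : IsGammaMap Γ μ φ :=
  hφ.isDistField.isGammaMap_pole hφ.not_bddBelow hφ.isPole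

theorem measurable_measure_awayFrom (hφ : Measurable φ) (hφ' : Measurable φ')
    (hψ : Measurable ψ) :
    Measurable fun b => (ψ b : Measure (GromovBoundary X)) (awayFrom (φ b.1) (φ' b.2)) := by
  have h1 : Measurable fun p : (B × B') × GromovBoundary X => φ p.1.1 :=
    hφ.comp (measurable_fst.comp measurable_fst)
  have h2 : Measurable fun p : (B × B') × GromovBoundary X => φ' p.1.2 :=
    hφ'.comp (measurable_snd.comp measurable_fst)
  exact measurable_measure_prodMk hψ (t := {p | p.2 ≠ φ p.1.1 ∧ p.2 ≠ φ' p.1.2})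
    ((measurableSet_eq_fun measurable_snd h1).compl.inter
      (measurableSet_eq_fun measurable_snd h2).compl)

theorem measurableSet_awayFrom (ξ η : GromovBoundary X) : MeasurableSet (awayFrom ξ η) :=
  (measurableSet_singleton ξ).compl.inter (measurableSet_singleton η).compl

/-- The mass outside the two poles is invariant. -/
theorem ae_measure_awayFrom_smul (hφ : IsGammaMap Γ μ φ) (hφ' : IsGammaMap Γ μ' φ')
    (hψ : IsGammaMap Γ (μ.prod μ') ψ) (g : Γ) : ∀ᵐ b ∂(μ.prod μ'),
      (ψ (g • b) : Measure (GromovBoundary X)) (awayFrom (φ (g • b.1)) (φ' (g • b.2))) =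
        (ψ b : Measure (GromovBoundary X)) (awayFrom (φ b.1) (φ' b.2)) := by
  filter_upwards [hψ.2 g, Measure.quasiMeasurePreserving_fst.ae (hφ.2 g),
    Measure.quasiMeasurePreserving_snd.ae (hφ'.2 g)] with b h1 h2 h3
  rw [h1, h2, h3, measure_smul_prob _ _ (measurableSet_awayFrom _ _)]
  congr 1
  ext ζ
  simp only [awayFrom, mem_preimage, mem_ofPred_eq, ne_eq, smul_left_cancel_iff]

variable [Countable Γ] [IsProbabilityMeasure μ] [IsProbabilityMeasure μ'] [StandardBorelSpace B]
  [StandardBorelSpace B']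

/-- A `Γ`-map `ψ` to the measures on the boundary which charges the complement of the two poles
makes the field `h` exactly equivariant. Most of the mass of `ψ (x, y)` outside the poles is on
points `ζ` for which the Gromov product of `φ' y` and `ζ` seen from `a • o` is at most `q`, if `q`
is large. When `a • o` moves to `φ x` the required `q` grows like the distance from `o`, so that
`h x a + q` is bounded below for such `(a, q)`. -/
theorem IsPoleField.exists_isExactField (hB : IsBoundaryPair Γ μ μ') (hφ : IsPoleField o μ h φ)
    (hφ' : IsGammaMap Γ μ' φ') (hdist : ∀ᵐ b ∂(μ.prod μ'), φ b.1 ≠ φ' b.2)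
    (hψ : IsGammaMap Γ (μ.prod μ') ψ) (hpos : ∀ᵐ b ∂(μ.prod μ'),
      (ψ b : Measure (GromovBoundary X)) (awayFrom (φ b.1) (φ' b.2)) ≠ 0) :
    ∃ k : B → Γ → ℝ, IsExactField o μ k := by
  let D : B × B' → Γ → ℕ → Set (GromovBoundary X) := fun b a q =>
    {ζ | ζ ∈ awayFrom (φ b.1) (φ' b.2) ∧ (φ' b.2, ζ) ∉ nearPairs (a • o) q}
  have hφm := hφ.isGammaMap.1
  have hφ'm := hφ'.1
  have hpair : ∀ b : B × B', Measurable fun ζ : GromovBoundary X => (φ' b.2, ζ) := fun b =>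
    measurable_const.prodMk measurable_id
  have hDm : ∀ b a q, MeasurableSet (D b a q) := fun b a q =>
    (measurableSet_awayFrom _ _).inter (hpair b isOpen_interior.measurableSet).compl
  have hDmeas : ∀ a q, Measurable fun b => (ψ b : Measure (GromovBoundary X)) (D b a q) := by
    intro a q
    have h1 : Measurable fun p : (B × B') × GromovBoundary X => φ p.1.1 :=
      hφm.comp (measurable_fst.comp measurable_fst)
    have h2 : Measurable fun p : (B × B') × GromovBoundary X => φ' p.1.2 :=
      hφ'm.comp (measurable_snd.comp measurable_fst)
    exact measurable_measure_prodMk hψ.1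
      (t := {p | (p.2 ≠ φ p.1.1 ∧ p.2 ≠ φ' p.1.2) ∧ (φ' p.1.2, p.2) ∉ nearPairs (a • o) q})
      (((measurableSet_eq_fun measurable_snd h1).compl.inter
        (measurableSet_eq_fun measurable_snd h2).compl).inter
          ((h2.prodMk measurable_snd) isOpen_interior.measurableSet).compl)
  refine hφ.isDistField.exists_isExactField hB (P := fun b a q =>
    (ψ b : Measure (GromovBoundary X)) (awayFrom (φ b.1) (φ' b.2)) / 2 ≤
      (ψ b : Measure (GromovBoundary X)) (D b a q))
    (fun a q => measurableSet_le
      ((measurable_measure_awayFrom hφm hφ'm hψ.1).div_const 2) (hDmeas a q))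
    (fun g => ?_) ?_ fun hcon => ?_
  · filter_upwards [ae_measure_awayFrom_smul hφ.isGammaMap hφ' hψ g, hψ.2 g,
      Measure.quasiMeasurePreserving_fst.ae (hφ.isGammaMap.2 g),
      Measure.quasiMeasurePreserving_snd.ae (hφ'.2 g)] with b h0 h1 h2 h3 a q
    have h4 : (fun v => g • v) ⁻¹' D (g • b) (g * a) q = D b a q := by
      ext ζ
      have h5 := smul_mem_nearPairs_iff g (a • o) q (φ' b.2, ζ)
      change (g • φ' b.2, g • ζ) ∈ nearPairs (g • a • o) q ↔ _ at h5
      have h2' : φ (g • b).1 = g • φ b.1 := h2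
      have h3' : φ' (g • b).2 = g • φ' b.2 := h3
      simp only [D, awayFrom, mem_preimage, mem_ofPred_eq, ne_eq, h2', h3', smul_left_cancel_iff,
        mul_smul, h5]
    have h5 : (ψ (g • b) : Measure (GromovBoundary X)) (D (g • b) (g * a) q) =
        (ψ b : Measure (GromovBoundary X)) (D b a q) := by
      rw [← h4, h1, measure_smul_prob _ _ (hDm _ _ _)]
    change _ / 2 ≤ _ ↔ _
    rw [h5]
    exact iff_of_eq (congrArg (fun t => t / 2 ≤ _) h0)
  · filter_upwards [hpos] with b hb
    have h1 : Monotone (D b 1) := fun q q' hq ζ hζ => ⟨hζ.1, fun h => hζ.2 (nearPairs_anti _ hq h)⟩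
    have h2 : ⋃ q, D b 1 q = awayFrom (φ b.1) (φ' b.2) := by
      ext ζ
      simp only [mem_iUnion]
      refine ⟨fun ⟨q, hq⟩ => hq.1, fun hζ => ?_⟩
      obtain ⟨q, hq⟩ := exists_notMem_nearPairs ((1 : Γ) • o) hζ.2.symm
      exact ⟨q, hζ, hq⟩
    have h3 := tendsto_measure_iUnion_atTop (μ := (ψ b : Measure (GromovBoundary X))) h1
    rw [h2] at h3
    obtain ⟨q, hq⟩ :=
      (h3.eventually_const_lt (ENNReal.half_lt_self hb (measure_ne_top _ _))).exists
    exact ⟨1, q, hq.le⟩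
  · obtain ⟨b, hb, hne, hpos⟩ := (hcon.and (hdist.and hpos)).exists
    have h1 : ∀ k : ℕ, ∃ a q, (ψ b : Measure (GromovBoundary X)) (awayFrom (φ b.1) (φ' b.2)) / 2 ≤
        (ψ b : Measure (GromovBoundary X)) (D b a q) ∧ h b.1 a + q ≤ -(k : ℝ) := by
      intro k
      by_contra! h3
      refine hb ⟨-k, ?_⟩
      rintro _ ⟨a, q, ha, rfl⟩
      exact (h3 a q ha).le
    choose a q hD hk using h1
    have hlim : TendsToBoundary (fun k => a k • o) (φ b.1) := by
      have h3 : Tendsto (fun k : ℕ => -(k : ℝ)) atTop atBot :=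
        tendsto_neg_atTop_atBot.comp tendsto_natCast_atTop_atTop
      refine hφ.isPole b.1 a (tendsto_atBot_mono (fun k => ?_) h3)
      have : (0 : ℝ) ≤ q k := (q k).cast_nonneg
      linarith [hk k]
    -- every point lies in finitely many of the sets `D b (a k) (q k)` only
    have hfin : ∀ ζ ∈ awayFrom (φ b.1) (φ' b.2), ∀ᶠ k in atTop, ζ ∉ D b (a k) (q k) := by
      intro ζ hζ
      obtain ⟨C, hC⟩ := eventually_mem_nearPairs o hlim hne hζ.1.symm
      obtain ⟨N, hN⟩ := exists_nat_ge (C - h b.1 1)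
      filter_upwards [hC, eventually_ge_atTop N] with k h3 h4 h5
      refine h5.2 (h3 (q k) ?_)
      have h6 := (hφ.isDistField.average b.1).sub_le_dist 1 (a k)
      rw [one_smul] at h6
      have h7 : (N : ℝ) ≤ k := by exact_mod_cast h4
      linarith [hk k]
    -- by continuity of the measure, more than half of the mass outside the poles avoids all but
    -- finitely many of these sets, each of which has at least half of that mass
    let E : ℕ → Set (GromovBoundary X) := fun N =>
      {ζ | ζ ∈ awayFrom (φ b.1) (φ' b.2) ∧ ∀ k, N ≤ k → ζ ∉ D b (a k) (q k)}
    have hE : Monotone E := fun N N' hN ζ hζ => ⟨hζ.1, fun k hk => hζ.2 k (hN.trans hk)⟩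
    have hEU : ⋃ N, E N = awayFrom (φ b.1) (φ' b.2) := by
      ext ζ
      simp only [mem_iUnion]
      refine ⟨fun ⟨q, hq⟩ => hq.1, fun hζ => ?_⟩
      obtain ⟨N, hN⟩ := eventually_atTop.1 (hfin ζ hζ)
      exact ⟨N, hζ, hN⟩
    have h3 := tendsto_measure_iUnion_atTop (μ := (ψ b : Measure (GromovBoundary X))) hE
    rw [hEU] at h3
    obtain ⟨N, hN⟩ :=
      (h3.eventually_const_lt (ENNReal.half_lt_self hpos (measure_ne_top _ _))).exists
    have h4 : (ψ b : Measure (GromovBoundary X)) (E N) +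
        (ψ b : Measure (GromovBoundary X)) (D b (a N) (q N)) ≤
          (ψ b : Measure (GromovBoundary X)) (awayFrom (φ b.1) (φ' b.2)) := by
      rw [← measure_union (Set.disjoint_left.2 fun ζ hζ => hζ.2 N le_rfl) (hDm _ _ _)]
      exact measure_mono (union_subset (fun ζ hζ => hζ.1) fun ζ hζ => hζ.1)
    refine absurd h4 (not_le.2 ?_)
    calc (ψ b : Measure (GromovBoundary X)) (awayFrom (φ b.1) (φ' b.2))
        = (ψ b : Measure (GromovBoundary X)) (awayFrom (φ b.1) (φ' b.2)) / 2 +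
          (ψ b : Measure (GromovBoundary X)) (awayFrom (φ b.1) (φ' b.2)) / 2 :=
            (ENNReal.add_halves _).symm
      _ < _ := ENNReal.add_lt_add_of_lt_of_le
            (ENNReal.div_ne_top (measure_ne_top _ _) two_ne_zero) hN (hD N)

/-- A `Γ`-map from the product to the measures on the boundary is concentrated on the poles. -/
theorem IsPoleField.ae_measure_awayFrom_eq_zero (hne : IsNonElementary Γ X)
    (hB : IsBoundaryPair Γ μ μ') (hφ : IsPoleField o μ h φ) (hφ' : IsPoleField o μ' h' φ')
    (hdist : ∀ᵐ b ∂(μ.prod μ'), φ b.1 ≠ φ' b.2) (hψ : IsGammaMap Γ (μ.prod μ') ψ) :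
    ∀ᵐ b ∂(μ.prod μ'), (ψ b : Measure (GromovBoundary X)) (awayFrom (φ b.1) (φ' b.2)) = 0 := by
  refine (hB.ergodic (A := {b | (ψ b : Measure (GromovBoundary X))
    (awayFrom (φ b.1) (φ' b.2)) = 0}) (measurable_measure_awayFrom hφ.isGammaMap.1
      hφ'.isGammaMap.1 hψ.1 (measurableSet_singleton 0)) fun g => ?_).resolve_right fun hpos => ?_
  · filter_upwards [ae_measure_awayFrom_smul hφ.isGammaMap hφ'.isGammaMap hψ g] with b hb
    exact iff_of_eq (congrArg (· = 0) hb)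
  · have hs : Measure.QuasiMeasurePreserving Prod.swap (μ'.prod μ) (μ.prod μ') :=
      Measure.measurePreserving_swap.quasiMeasurePreserving
    obtain ⟨k, hk⟩ := hφ.exists_isExactField hB hφ'.isGammaMap hdist hψ hpos
    obtain ⟨k', hk'⟩ := hφ'.exists_isExactField hB.symm hφ.isGammaMap (ψ := ψ ∘ Prod.swap)
      (by filter_upwards [hs.ae hdist] with b hb using hb.symm)
      ⟨hψ.1.comp measurable_swap, fun g => hs.ae (hψ.2 g)⟩
      (by
        filter_upwards [hs.ae hpos] with b hb
        rw [awayFrom_comm]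
        exact hb)
    exact hk.not_both hne hB hk'

end Lift

/-! ### Classification of the equivariant maps -/

section Classification

variable {Γ : Type*} [Group Γ] {X : Type*} [MetricSpace X] [IsGromovHyperbolic X] [MulAction Γ X]
  [IsIsometricSMul Γ X]
  {B B' : Type*} [MeasurableSpace B] [MulAction Γ B] [MeasurableSpace B'] [MulAction Γ B']
  {μ : Measure B} {μ' : Measure B'} {φ : B → GromovBoundary X} {φ' : B' → GromovBoundary X}

theorem IsGammaMap.diracProba (hφ : IsGammaMap Γ μ φ) :
    IsGammaMap Γ μ fun b => diracProba (φ b) :=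
  ⟨measurable_diracProba.comp hφ.1, fun g => by
    filter_upwards [hφ.2 g] with b hb
    rw [hb, smul_diracProba]⟩

theorem IsGammaMap.comp_fst {V : Type*} [MeasurableSpace V] [SMul Γ V] {f : B → V}
    (hf : IsGammaMap Γ μ f) : IsGammaMap Γ (μ.prod μ') (f ∘ Prod.fst) :=
  ⟨hf.1.comp measurable_fst, fun g => Measure.quasiMeasurePreserving_fst.ae (hf.2 g)⟩

theorem IsGammaMap.comp_snd {V : Type*} [MeasurableSpace V] [SMul Γ V] {f : B' → V}
    (hf : IsGammaMap Γ μ' f) : IsGammaMap Γ (μ.prod μ') (f ∘ Prod.snd) :=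
  ⟨hf.1.comp measurable_snd, fun g => Measure.quasiMeasurePreserving_snd.ae (hf.2 g)⟩

/-- A `Γ`-map to the boundary is not constant, as `Γ` fixes no boundary point. -/
theorem IsGammaMap.not_ae_const [NeZero μ] (hne : IsNonElementary Γ X)
    (hs : IsNonsingularAction Γ μ) (hφ : IsGammaMap Γ μ φ) (ξ : GromovBoundary X) :
    ¬ ∀ᵐ x ∂μ, φ x = ξ := by
  refine fun hξ => hne.point ⟨ξ, fun g => ?_⟩
  obtain ⟨x, h1, h2, h3⟩ :=
    (hξ.and ((hφ.2 g).and ((hs.quasiMeasurePreserving g).ae hξ))).exists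
  rw [← h1, ← h2, h3, h1]

/-- If every `Γ`-map from the product to the measures on the boundary is concentrated on the
values of `φ` and `φ'`, then every such map from the first factor is given by the Dirac masses at
the values of `φ`, because `φ'` is not constant. -/
theorem IsBoundaryPair.eq_diracProba_of_ae [IsProbabilityMeasure μ'] (hne : IsNonElementary Γ X)
    (hB : IsBoundaryPair Γ μ μ') (hφ' : IsGammaMap Γ μ' φ')
    {ψ : B → ProbabilityMeasure (GromovBoundary X)}
    (hψ : ∀ᵐ b ∂(μ.prod μ'),
      (ψ b.1 : Measure (GromovBoundary X)) (awayFrom (φ b.1) (φ' b.2)) = 0) :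
    ψ =ᵐ[μ] fun b => diracProba (φ b) := by
  filter_upwards [Measure.ae_ae_of_ae_prod hψ] with x hx
  obtain ⟨y₁, h1⟩ := hx.exists
  obtain ⟨y₂, h2, h3⟩ : ∃ y, (ψ x : Measure (GromovBoundary X)) (awayFrom (φ x) (φ' y)) = 0 ∧
      φ' y ≠ φ' y₁ := by
    by_contra! hcon
    exact hφ'.not_ae_const hne hB.nonsingular_plus (φ' y₁) (hx.mono hcon)
  refine eq_diracProba (measure_mono_null (fun ζ hζ => ?_) (measure_union_null h1 h2))
  by_cases h : ζ = φ' y₁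
  · exact Or.inr ⟨hζ, fun h' => h3 (h'.symm.trans h)⟩
  · exact Or.inl ⟨hζ, h⟩

variable [Nonempty X] [TopologicalSpace.SeparableSpace X]

/-- A `Γ`-map to pairs which are distinct almost everywhere defines a `Γ`-map to `∂X⁽²⁾`. -/
theorem IsGammaMap.exists_distinctPairs {Ω : Type*} [MeasurableSpace Ω] [MulAction Γ Ω]
    {ν : Measure Ω} [NeZero ν] (hs : ∀ g : Γ, Measure.QuasiMeasurePreserving (fun ω => g • ω) ν ν)
    {F : Ω → GromovBoundary X × GromovBoundary X} (hF : IsGammaMap Γ ν F)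
    (hne : ∀ᵐ ω ∂ν, (F ω).1 ≠ (F ω).2) :
    ∃ Φ : Ω → DistinctPairs X, IsGammaMap Γ ν Φ ∧ ∀ᵐ ω ∂ν, (Φ ω).1 = F ω := by
  classical
  obtain ⟨ω₀, hω₀⟩ := hne.exists
  let F' : Ω → GromovBoundary X × GromovBoundary X := fun ω =>
    if (F ω).1 ≠ (F ω).2 then F ω else F ω₀
  have hF' : ∀ ω, (F' ω).1 ≠ (F' ω).2 := fun ω => by
    by_cases h : (F ω).1 ≠ (F ω).2
    · simpa only [F', if_pos h] using h
    · simpa only [F', if_neg h] using hω₀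
  have heq : ∀ᵐ ω ∂ν, F' ω = F ω := hne.mono fun ω h => if_pos h
  refine ⟨fun ω => ⟨F' ω, hF' ω⟩, ⟨Measurable.subtype_mk (Measurable.ite (measurableSet_eq_fun
    (measurable_fst.comp hF.1) (measurable_snd.comp hF.1)).compl hF.1 measurable_const),
      fun g => ?_⟩, heq⟩
  filter_upwards [heq, hF.2 g, (hs g).ae heq] with ω h1 h2 h3
  refine Subtype.ext ?_
  change F' (g • ω) = g • F' ω
  rw [h3, h2, h1]

variable [IsProbabilityMeasure μ] [IsProbabilityMeasure μ'] [StandardBorelSpace B]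
  [StandardBorelSpace B']

theorem IsBoundaryPair.ae_ne (hne : IsNonElementary Γ X) (hB : IsBoundaryPair Γ μ μ')
    (hφ : IsGammaMap Γ μ φ) (hφ' : IsGammaMap Γ μ' φ') :
    ∀ᵐ b ∂(μ.prod μ'), φ b.1 ≠ φ' b.2 := by
  refine (hB.ergodic (A := {b | φ b.1 = φ' b.2}) (measurableSet_eq_fun
    (hφ.1.comp measurable_fst) (hφ'.1.comp measurable_snd)) fun g => ?_).resolve_left fun heq => ?_
  · filter_upwards [Measure.quasiMeasurePreserving_fst.ae (hφ.2 g),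
      Measure.quasiMeasurePreserving_snd.ae (hφ'.2 g)] with b h1 h2
    change φ (g • b.1) = φ' (g • b.2) ↔ φ b.1 = φ' b.2
    rw [h1, h2, smul_left_cancel_iff]
  · obtain ⟨x, hx⟩ := (Measure.ae_ae_of_ae_prod heq).exists
    refine hφ'.not_ae_const hne hB.nonsingular_plus (φ x) ?_
    filter_upwards [hx] with y hy using Eq.symm hy

/-- A `Γ`-map from the product to the boundary with values among the values of `φ` and `φ'`
is one of the two, by ergodicity. -/
theorem IsBoundaryPair.eq_or_eq_of_ae (hB : IsBoundaryPair Γ μ μ') (hφ : IsGammaMap Γ μ φ)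
    {ψ : B × B' → GromovBoundary X}
    (hψ : IsGammaMap Γ (μ.prod μ') ψ)
    (h : ∀ᵐ b ∂(μ.prod μ'), ψ b = φ b.1 ∨ ψ b = φ' b.2) :
    ψ =ᵐ[μ.prod μ'] φ ∘ Prod.fst ∨ ψ =ᵐ[μ.prod μ'] φ' ∘ Prod.snd := by
  refine (hB.ergodic (A := {b | ψ b = φ b.1}) (measurableSet_eq_fun hψ.1
    (hφ.1.comp measurable_fst)) fun g => ?_).imp id fun hn => ?_
  · filter_upwards [hψ.2 g, Measure.quasiMeasurePreserving_fst.ae (hφ.2 g)] with b h1 h2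
    change ψ (g • b) = φ (g • b.1) ↔ ψ b = φ b.1
    rw [h1, h2, smul_left_cancel_iff]
  · filter_upwards [h, hn] with b h1 h2 using h1.resolve_left h2

end Classification

end BoundaryMaps

theorem theorem2p2
    {Γ : Type*} [Group Γ] [Countable Γ]
    {Bm : Type*} [MeasurableSpace Bm] [StandardBorelSpace Bm] [MulAction Γ Bm]
    (μm : Measure Bm) [IsProbabilityMeasure μm]
    {Bp : Type*} [MeasurableSpace Bp] [StandardBorelSpace Bp] [MulAction Γ Bp]
    (μp : Measure Bp) [IsProbabilityMeasure μp]
    (hB : IsBoundaryPair Γ μm μp)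
    {X : Type*} [MetricSpace X] [Nonempty X] [TopologicalSpace.SeparableSpace X]
    [IsGromovHyperbolic X] (hgeod : IsGeodesicSpace X)
    [MulAction Γ X] [IsIsometricSMul Γ X]
    (hbdd : ¬ ∃ A : Set X, A.Nonempty ∧ Bornology.IsBounded A ∧
      ∀ g : Γ, (fun x => g • x) '' A = A)
    (hpoint : ¬ ∃ ξ : GromovBoundary X, ∀ g : Γ, g • ξ = ξ)
    (hpair : ¬ ∃ ξ η : GromovBoundary X, ξ ≠ η ∧
      ∀ g : Γ, ({g • ξ, g • η} : Set (GromovBoundary X)) = {ξ, η}) :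
    ∃ (φm : Bm → GromovBoundary X) (φp : Bp → GromovBoundary X),
      IsGammaMap Γ μm φm ∧ IsGammaMap Γ μp φp ∧
      -- the product map is a `Γ`-map essentially contained in the set of distinct pairs
      IsGammaMap Γ (μm.prod μp) (fun b => (φm b.1, φp b.2)) ∧
      (∀ᵐ b ∂(μm.prod μp), φm b.1 ≠ φp b.2) ∧
      -- essential uniqueness
      (∀ ψ : Bm → GromovBoundary X, IsGammaMap Γ μm ψ → ψ =ᵐ[μm] φm) ∧
      (∀ ψ : Bp → GromovBoundary X, IsGammaMap Γ μp ψ → ψ =ᵐ[μp] φp) ∧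
      -- (i) the `Γ`-maps to `Prob(∂X)`
      (IsGammaMap Γ μm (fun b => diracProba (φm b)) ∧
        ∀ ψ : Bm → ProbabilityMeasure (GromovBoundary X), IsGammaMap Γ μm ψ →
          ψ =ᵐ[μm] fun b => diracProba (φm b)) ∧
      (IsGammaMap Γ μp (fun b => diracProba (φp b)) ∧
        ∀ ψ : Bp → ProbabilityMeasure (GromovBoundary X), IsGammaMap Γ μp ψ →
          ψ =ᵐ[μp] fun b => diracProba (φp b)) ∧
      -- (ii) the `Γ`-maps from the product to `∂X`
      (IsGammaMap Γ (μm.prod μp) (φm ∘ Prod.fst) ∧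
        IsGammaMap Γ (μm.prod μp) (φp ∘ Prod.snd) ∧
        ∀ ψ : Bm × Bp → GromovBoundary X, IsGammaMap Γ (μm.prod μp) ψ →
          ψ =ᵐ[μm.prod μp] φm ∘ Prod.fst ∨ ψ =ᵐ[μm.prod μp] φp ∘ Prod.snd) ∧
      -- (iii) the `Γ`-maps from the product to the set of distinct pairs
      ((∃ Φ : Bm × Bp → DistinctPairs X, IsGammaMap Γ (μm.prod μp) Φ ∧
          ∀ᵐ b ∂(μm.prod μp), (Φ b).1 = (φm b.1, φp b.2)) ∧
        (∃ Φ : Bm × Bp → DistinctPairs X, IsGammaMap Γ (μm.prod μp) Φ ∧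
          ∀ᵐ b ∂(μm.prod μp), (Φ b).1 = (φp b.2, φm b.1)) ∧
        ∀ Φ : Bm × Bp → DistinctPairs X, IsGammaMap Γ (μm.prod μp) Φ →
          (∀ᵐ b ∂(μm.prod μp), (Φ b).1 = (φm b.1, φp b.2)) ∨
          (∀ᵐ b ∂(μm.prod μp), (Φ b).1 = (φp b.2, φm b.1))) := by 
  have hne : IsNonElementary Γ X := ⟨hbdd, hpoint, hpair⟩
  obtain ⟨o⟩ := ‹Nonempty X›
  obtain ⟨h, φ, hp⟩ := hB.exists_isPoleField hne o
  obtain ⟨h', φ', hp'⟩ := hB.symm.exists_isPoleField hne o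
  have hφ := hp.isGammaMap
  have hφ' := hp'.isGammaMap
  have hdist := hB.ae_ne hne hφ hφ'
  have hs : Measure.QuasiMeasurePreserving Prod.swap (μp.prod μm) (μm.prod μp) :=
    Measure.measurePreserving_swap.quasiMeasurePreserving
  have hprob : ∀ ψ : Bm → ProbabilityMeasure (GromovBoundary X), IsGammaMap Γ μm ψ →
      ψ =ᵐ[μm] fun b => diracProba (φ b) := fun ψ hψ =>
    hB.eq_diracProba_of_ae hne hφ'
      (hp.ae_measure_awayFrom_eq_zero hne hB hp' hdist hψ.comp_fst)
  have hprob' : ∀ ψ : Bp → ProbabilityMeasure (GromovBoundary X), IsGammaMap Γ μp ψ →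
      ψ =ᵐ[μp] fun b => diracProba (φ' b) := fun ψ hψ => by
    refine hB.symm.eq_diracProba_of_ae hne hφ ?_
    filter_upwards [hs.ae (hp.ae_measure_awayFrom_eq_zero hne hB hp' hdist hψ.comp_snd)] with b hb
    rw [awayFrom_comm]
    exact hb
  have hprod : ∀ ψ : Bm × Bp → GromovBoundary X, IsGammaMap Γ (μm.prod μp) ψ →
      ψ =ᵐ[μm.prod μp] φ ∘ Prod.fst ∨ ψ =ᵐ[μm.prod μp] φ' ∘ Prod.snd := fun ψ hψ => by
    refine hB.eq_or_eq_of_ae hφ hψ ?_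
    filter_upwards [hp.ae_measure_awayFrom_eq_zero hne hB hp' hdist hψ.diracProba] with b hb
    by_contra! hcon
    have h1 : Measure.dirac (ψ b) (awayFrom (φ b.1) (φ' b.2)) = 0 := hb
    rw [Measure.dirac_apply_of_mem (show ψ b ∈ awayFrom (φ b.1) (φ' b.2) from hcon)] at h1
    exact one_ne_zero h1
  have hpairs : IsGammaMap Γ (μm.prod μp) fun b => (φ b.1, φ' b.2) :=
    ⟨(hφ.1.comp measurable_fst).prodMk (hφ'.1.comp measurable_snd), fun g => by
      filter_upwards [hφ.comp_fst.2 g, hφ'.comp_snd.2 g] with b h1 h2 using Prod.ext h1 h2⟩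
  have hpairs' : IsGammaMap Γ (μm.prod μp) fun b => (φ' b.2, φ b.1) :=
    ⟨(hφ'.1.comp measurable_snd).prodMk (hφ.1.comp measurable_fst), fun g => by
      filter_upwards [hφ.comp_fst.2 g, hφ'.comp_snd.2 g] with b h1 h2 using Prod.ext h2 h1⟩
  refine ⟨φ, φ', hφ, hφ', hpairs, hdist, fun ψ hψ => ?_, fun ψ hψ => ?_,
    ⟨hφ.diracProba, hprob⟩, ⟨hφ'.diracProba, hprob'⟩, ⟨hφ.comp_fst, hφ'.comp_snd, hprod⟩,
    hpairs.exists_distinctPairs hB.quasiMeasurePreserving hdist,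
    hpairs'.exists_distinctPairs hB.quasiMeasurePreserving (hdist.mono fun b hb => hb.symm),
    fun Φ hΦ => ?_⟩
  · exact (hprob _ hψ.diracProba).mono fun x hx => injective_diracProba hx
  · exact (hprob' _ hψ.diracProba).mono fun x hx => injective_diracProba hx
  · have hcoe : ∀ g : Γ, ∀ᵐ b ∂(μm.prod μp), (Φ (g • b)).1 = g • (Φ b).1 := fun g =>
      (hΦ.2 g).mono fun b hb => congrArg Subtype.val hb
    have hm : Measurable fun b => (Φ b).1 := measurable_subtype_coe.comp hΦ.1
    -- the two components of `Φ` are not the same one of the two maps, as they are distinct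
    rcases hprod (fun b => (Φ b).1.1) ⟨measurable_fst.comp hm, fun g =>
      (hcoe g).mono fun b hb => congrArg Prod.fst hb⟩ with h1 | h1 <;>
    rcases hprod (fun b => (Φ b).1.2) ⟨measurable_snd.comp hm, fun g =>
      (hcoe g).mono fun b hb => congrArg Prod.snd hb⟩ with h2 | h2
    · obtain ⟨b, h3, h4⟩ := (h1.and h2).exists
      exact absurd (h3.trans h4.symm) (Φ b).2
    · exact Or.inl (by filter_upwards [h1, h2] with b h3 h4 using Prod.ext h3 h4)
    · exact Or.inr (by filter_upwards [h1, h2] with b h3 h4 using Prod.ext h3 h4)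
    · obtain ⟨b, h3, h4⟩ := (h1.and h2).exists
      exact absurd (h3.trans h4.symm) (Φ b).2
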